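/- **Theorem 4.2.** Let $\mathcal T$ be a strict tensor $C^*$-category with irreducible tensor unit, $(\iota,\iota)=\mathbb C$ (more generally, a not necessarily strict tensor $C^*$-category with unitary associativity and unit constraints, which are suppressed in the formulas). Suppose that $\mathcal T$ has conjugates: every object $\rho$ has an object $\overline\rho$ and arrows $R_\rho\in(\iota,\overline\rho\rho)$, $\overline R_\rho\in(\iota,\rho\overline\rho)$ solving the conjugate equations $$(\overline R_\rho^*\times 1_\rho)\circ(1_\rho\times R_\rho)=1_\rho,\qquad (R_\rho^*\times 1_{\overline\rho})\circ(1_{\overline\rho}\times\overline R_\rho)=1_{\overline\rho}.$$ A solution is *standard* if it is a finite direct sum of normalized solutions for irreducibles, that is, if there are minimal projections $E_i\in(\rho,\rho)$ and projections $F_i\in(\overline\rho,\overline\rho)$, with $\sum_iE_i=1_\rho$ and $\sum_iF_i=1_{\overline\rho}$, such that $R_\rho=\sum_i(F_i\times E_i)\circ R_\rho$, $\overline R_\rho=\sum_i(E_i\times F_i)\circ\overline R_\rho$ and $\|(F_i\times E_i)\circ R_\rho\|=\|(E_i\times F_i)\circ\overline R_\rho\|$ for all $i$. (Minimal means $E_i\neq0$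 and $E_i(\rho,\rho)E_i=\mathbb CE_i$.) A *conjugation* on $\mathcal T$ is an extension of $\mathcal T$, with the same objects and linear arrows, to a semilinear tensor $C^*$-category $\mathcal T^a$ in which every object is the source of an antiunitary. Here one adjoins Banach spaces $(\rho,\sigma)_a$ of antilinear arrows with associative compositions (of the evident linearity or antilinearity), an adjoint and a submultiplicative $C^*$-norm, such that $r^*\circ r$ is positive for every antilinear $r$, and an associative bilinear tensor product $(\rho,\sigma)_a\times(\rho',\sigma')_a\to(\rho\rho',\sigma'\sigma)_a$ of antilinear arrows, which has an antiunitary unit in $(\iota,\iota)_a$ and satisfies $(R\times R')^*=R'^*\times R^*$, $(S'\times S)\circ(R\times R')=(S\circ R)\times(S'\circ R')$ for $S,S'$ both linear or both antilinear, and $(R\times R')\circ(P\times P')=(R\circ P)\times(R'\circ P')$ for $P,P'$ linear. Then: 1. Every object of $\mathcal T$ has a standard solution of the conjugate equations. 2. Let $\rho\mapsto(\overline\rho,R_\rho,\overline R_\rho)$ be any choice of standard solutions. The equation $$(\overline S\times 1_\rho)\circ R_\rho=(1_{\overline\sigma}\times S^*)\circ R_\sigma,\qquad S\in(\rho,\sigma),$$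 defines a unique antilinear $*$-functor $S\mapsto\overline S\in(\overline\rho,\overline\sigma)$. The arrows $$c_{\rho,\sigma}=\bigl(1_{\overline{\rho\sigma}}\times(\overline R_\rho^*\circ(1_\rho\times\overline R_\sigma^*\times 1_{\overline\rho}))\bigr)\circ(R_{\rho\sigma}\times 1_{\overline\sigma\,\overline\rho})\in(\overline\sigma\,\overline\rho,\overline{\rho\sigma}),\qquad d_\rho=(1_{\overline{\overline\rho}}\times R_\rho^*)\circ(R_{\overline\rho}\times 1_\rho)\in(\rho,\overline{\overline\rho})$$ are natural unitaries, and $$c_{\tau,\sigma\rho}\circ(c_{\sigma,\rho}\times 1_{\overline\tau})=c_{\tau\sigma,\rho}\circ(1_{\overline\rho}\times c_{\tau,\sigma}),\qquad \overline{c_{\rho,\sigma}}\circ c_{\overline\sigma,\overline\rho}\circ(d_\rho\times d_\sigma)=d_{\rho\sigma},\qquad \overline{d_\rho}=d_{\overline\rho}.$$ There are a conjugation $\mathcal T^a$ on $\mathcal T$ and antiunitaries $J_\rho\in(\rho,\overline\rho)_a$ with $$\overline S=J_\sigma\circ S\circ J_\rho^*,\qquad d_\rho=J_{\overline\rho}\circ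 J_\rho,\qquad c_{\rho,\sigma}=J_{\rho\sigma}\circ(J_\rho\times J_\sigma)^*.$$ 3. This conjugation does not depend on the choice of standard solutions. If $\rho\mapsto(\tilde\rho,\tilde R_\rho,\tilde{\overline R}_\rho)$ is another choice, then for each $\rho$ there is a unique arrow $U_\rho\in(\overline\rho,\tilde\rho)$ with $\tilde R_\rho=(U_\rho\times1_\rho)\circ R_\rho$, and $U_\rho$ is unitary. If $(\mathcal T^a,J)$ and $(\tilde{\mathcal T}^a,\tilde J)$ are as in 2 for the two choices, then there is a unique isomorphism $\tilde{\mathcal T}^a\to\mathcal T^a$ of semilinear tensor $C^*$-categories that is the identity on objects and on linear arrows and takes $\tilde J_\rho$ to $U_\rho\circ J_\rho$ for every $\rho$. -/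

import Mathlib

open CategoryTheory MonoidalCategory
open scoped ComplexConjugate

universe v u

/-- A (complex) C*-category: the spaces of arrows are complex Banach spaces, composition is bilinear
and submultiplicative, and `adj` is the adjoint `f ↦ f*`, an antilinear contravariant involution
fixing the objects, with the C*-property and with every `f* ∘ f` positive.
Recall that `f ≫ g` is `g ∘ f`. -/
class CStarCategory (C : Type u) [Category.{v} C] where
  [homNormed : ∀ X Y : C, NormedAddCommGroup (X ⟶ Y)]
  [homSpace : ∀ X Y : C, NormedSpace ℂ (X ⟶ Y)]
  [homComplete : ∀ X Y : C, CompleteSpace (X ⟶ Y)]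
  add_comp : ∀ {X Y Z : C} (f f' : X ⟶ Y) (g : Y ⟶ Z), (f + f') ≫ g = f ≫ g + f' ≫ g
  comp_add : ∀ {X Y Z : C} (f : X ⟶ Y) (g g' : Y ⟶ Z), f ≫ (g + g') = f ≫ g + f ≫ g'
  smul_comp : ∀ {X Y Z : C} (a : ℂ) (f : X ⟶ Y) (g : Y ⟶ Z), (a • f) ≫ g = a • (f ≫ g)
  comp_smul : ∀ {X Y Z : C} (a : ℂ) (f : X ⟶ Y) (g : Y ⟶ Z), f ≫ (a • g) = a • (f ≫ g)
  norm_comp_le : ∀ {X Y Z : C} (f : X ⟶ Y) (g : Y ⟶ Z), ‖f ≫ g‖ ≤ ‖f‖ * ‖g‖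
  /-- the adjoint -/
  adj : ∀ {X Y : C}, (X ⟶ Y) → (Y ⟶ X)
  adj_adj : ∀ {X Y : C} (f : X ⟶ Y), adj (adj f) = f
  adj_comp : ∀ {X Y Z : C} (f : X ⟶ Y) (g : Y ⟶ Z), adj (f ≫ g) = adj g ≫ adj f
  adj_add : ∀ {X Y : C} (f g : X ⟶ Y), adj (f + g) = adj f + adj g
  adj_smul : ∀ {X Y : C} (a : ℂ) (f : X ⟶ Y), adj (a • f) = conj a • adj f
  norm_comp_adj : ∀ {X Y : C} (f : X ⟶ Y), ‖f ≫ adj f‖ = ‖f‖ ^ 2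
  comp_adj_positive : ∀ {X Y : C} (f : X ⟶ Y), ∃ h : X ⟶ X, f ≫ adj f = h ≫ adj h

attribute [reducible, instance] CStarCategory.homNormed CStarCategory.homSpace
attribute [instance] CStarCategory.homComplete

open CStarCategory (adj)

/-- An arrow `U` with `U* ∘ U = 1` and `U ∘ U* = 1`. -/
def IsUnitaryArrow {C : Type u} [Category.{v} C] [CStarCategory C] {X Y : C} (U : X ⟶ Y) : Prop :=
  U ≫ adj U = 𝟙 X ∧ adj U ≫ U = 𝟙 Y

/-- A tensor C*-category: a C*-category with a monoidal structure whose tensor product is bilinear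
on arrows and commutes with the adjoint, and whose structural isomorphisms are unitary. The strict
tensor C*-categories are those whose structural isomorphisms are identities. -/
class TensorCStarCategory (C : Type u) [Category.{v} C] [MonoidalCategory C]
    extends CStarCategory C where
  add_tensor : ∀ {X Y X' Y' : C} (f g : X ⟶ Y) (h : X' ⟶ Y'),
    (f + g) ⊗ₘ h = (f ⊗ₘ h) + (g ⊗ₘ h)
  tensor_add : ∀ {X Y X' Y' : C} (f : X ⟶ Y) (g h : X' ⟶ Y'),
    f ⊗ₘ (g + h) = (f ⊗ₘ g) + (f ⊗ₘ h)
  smul_tensor : ∀ {X Y X' Y' : C} (a : ℂ) (f : X ⟶ Y) (g : X' ⟶ Y'),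
    (a • f) ⊗ₘ g = a • (f ⊗ₘ g)
  tensor_smul : ∀ {X Y X' Y' : C} (a : ℂ) (f : X ⟶ Y) (g : X' ⟶ Y'),
    f ⊗ₘ (a • g) = a • (f ⊗ₘ g)
  adj_tensor : ∀ {X Y X' Y' : C} (f : X ⟶ Y) (g : X' ⟶ Y'), adj (f ⊗ₘ g) = adj f ⊗ₘ adj g
  adj_associator : ∀ X Y Z : C, adj (α_ X Y Z).hom = (α_ X Y Z).inv
  adj_leftUnitor : ∀ X : C, adj (λ_ X).hom = (λ_ X).inv
  adj_rightUnitor : ∀ X : C, adj (ρ_ X).hom = (ρ_ X).inv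

/-! ### Conjugate equations -/

section Conjugates

variable {C : Type u} [Category.{v} C] [MonoidalCategory C] [TensorCStarCategory C]

/-- A conjugate `bar` of `X` together with a solution `R : ι → bar ⊗ X`, `Rbar : ι → X ⊗ bar` of
the conjugate equations
`(Rbar* × 1_X) ∘ (1_X × R) = 1_X` and `(R* × 1_bar) ∘ (1_bar × Rbar) = 1_bar`. -/
structure ConjugateSolution (X : C) where
  bar : C
  R : 𝟙_ C ⟶ bar ⊗ X
  Rbar : 𝟙_ C ⟶ X ⊗ bar
  conj_eq : (ρ_ X).inv ≫ X ◁ R ≫ (α_ X bar X).inv ≫ adj Rbar ▷ X ≫ (λ_ X).hom = 𝟙 X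
  conj_eq_bar : (ρ_ bar).inv ≫ bar ◁ Rbar ≫ (α_ bar X bar).inv ≫ adj R ▷ bar ≫ (λ_ bar).hom
    = 𝟙 bar

/-- `E` is a projection in `(X, X)`. -/
def IsProjectionArrow {X : C} (E : X ⟶ X) : Prop :=
  E ≫ E = E ∧ adj E = E

/-- `E` is a minimal projection, that is, the subobject of `X` that it determines is irreducible:
`E (X, X) E = ℂ E` and `E ≠ 0`. -/
def IsMinimalProjectionArrow {X : C} (E : X ⟶ X) : Prop :=
  IsProjectionArrow E ∧ E ≠ 0 ∧ ∀ T : X ⟶ X, ∃ a : ℂ, E ≫ T ≫ E = a • E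

/-- A solution is standard if it is a direct sum of normalized solutions for irreducibles: `X` and
`bar` decompose into finitely many irreducibles, given by projections `E i` and `F i` adding up to
the identities, and correspondingly `R = ∑ i, R i`, `Rbar = ∑ i, Rbar i`, where
`R i = (F i × E i) ∘ R` and `Rbar i = (E i × F i) ∘ Rbar` are normalized, `‖R i‖ = ‖Rbar i‖`.
If `W i` and `V i` are isometries onto the subobjects, then `R i = (V i × W i) ∘ r i` and
`Rbar i = (W i × V i) ∘ rbar i` for a solution `r i`, `rbar i` for the `i`-th irreducible.
Stated with projections, the notion makes sense also where subobjects are not available. -/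
def ConjugateSolution.IsStandard {X : C} (s : ConjugateSolution X) : Prop :=
  ∃ (n : ℕ) (E : Fin n → (X ⟶ X)) (F : Fin n → (s.bar ⟶ s.bar)),
    (∀ i, IsMinimalProjectionArrow (E i)) ∧ (∀ i, IsProjectionArrow (F i)) ∧
    ∑ i, E i = 𝟙 X ∧ ∑ i, F i = 𝟙 s.bar ∧
    ∑ i, s.R ≫ (F i ⊗ₘ E i) = s.R ∧ ∑ i, s.Rbar ≫ (E i ⊗ₘ F i) = s.Rbar ∧
    ∀ i, ‖s.R ≫ (F i ⊗ₘ E i)‖ = ‖s.Rbar ≫ (E i ⊗ₘ F i)‖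

variable (C)

/-- The tensor unit `ι` is irreducible: `(ι, ι) = ℂ`. -/
def HasIrreducibleUnit : Prop :=
  𝟙 (𝟙_ C) ≠ 0 ∧ ∀ f : 𝟙_ C ⟶ 𝟙_ C, ∃ a : ℂ, f = a • 𝟙 (𝟙_ C)

/-- Every object has a conjugate, in the sense of Longo and Roberts. -/
def HasConjugates : Prop :=
  ∀ X : C, Nonempty (ConjugateSolution X)

/-- A choice, for every object, of a conjugate and a standard solution. -/
structure StandardChoice where
  sol : ∀ X : C, ConjugateSolution X
  standard : ∀ X : C, (sol X).IsStandard

end Conjugates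

namespace StandardChoice

variable {C : Type u} [Category.{v} C] [MonoidalCategory C] [TensorCStarCategory C]
  (S : StandardChoice C)

/-- The chosen conjugate object. -/
abbrev bar (X : C) : C := (S.sol X).bar

/-- The chosen `R`. -/
abbrev R (X : C) : 𝟙_ C ⟶ S.bar X ⊗ X := (S.sol X).R

/-- The chosen `Rbar`. -/
abbrev Rbar (X : C) : 𝟙_ C ⟶ X ⊗ S.bar X := (S.sol X).Rbar

/-- `Rbar_X* ∘ (1_X × Rbar_Y* × 1_{bar X}) : X Y (bar Y) (bar X) → ι`. -/
def eval (X Y : C) : (X ⊗ Y) ⊗ (S.bar Y ⊗ S.bar X) ⟶ 𝟙_ C :=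
  (α_ X Y (S.bar Y ⊗ S.bar X)).hom ≫
    X ◁ ((α_ Y (S.bar Y) (S.bar X)).inv ≫ adj (S.Rbar Y) ▷ S.bar X ≫ (λ_ (S.bar X)).hom) ≫
    adj (S.Rbar X)

/-- `c_{X,Y} = (1 × (Rbar_X* ∘ (1_X × Rbar_Y* × 1_{bar X}))) ∘ (R_{XY} × 1)`. -/
def c (X Y : C) : S.bar Y ⊗ S.bar X ⟶ S.bar (X ⊗ Y) :=
  (λ_ (S.bar Y ⊗ S.bar X)).inv ≫ S.R (X ⊗ Y) ▷ (S.bar Y ⊗ S.bar X) ≫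
    (α_ (S.bar (X ⊗ Y)) (X ⊗ Y) (S.bar Y ⊗ S.bar X)).hom ≫
    S.bar (X ⊗ Y) ◁ S.eval X Y ≫ (ρ_ (S.bar (X ⊗ Y))).hom

/-- `d_X = (1 × R_X*) ∘ (R_{bar X} × 1_X)`. -/
def d (X : C) : X ⟶ S.bar (S.bar X) :=
  (λ_ X).inv ≫ S.R (S.bar X) ▷ X ≫ (α_ (S.bar (S.bar X)) (S.bar X) X).hom ≫
    S.bar (S.bar X) ◁ adj (S.R X) ≫ (ρ_ (S.bar (S.bar X))).hom

end StandardChoice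

/-! ### Conjugations given by an antilinear functor and natural transformations -/

/-- A conjugation given by an antilinear *-functor `T ↦ map T`, with action `bar` on objects, and
natural unitaries `d_X : X → bar (bar X)` and `c_{X,Y} : (bar Y)(bar X) → bar (XY)`,
satisfying the coherence identities. -/
structure FunctorialConjugation {C : Type u} [Category.{v} C] [MonoidalCategory C]
    [TensorCStarCategory C] (bar : C → C) where
  map : ∀ {X Y : C}, (X ⟶ Y) → (bar X ⟶ bar Y)
  map_id : ∀ X : C, map (𝟙 X) = 𝟙 (bar X)
  map_comp : ∀ {X Y Z : C} (f : X ⟶ Y) (g : Y ⟶ Z), map (f ≫ g) = map f ≫ map g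
  map_add : ∀ {X Y : C} (f g : X ⟶ Y), map (f + g) = map f + map g
  map_smul : ∀ {X Y : C} (a : ℂ) (f : X ⟶ Y), map (a • f) = conj a • map f
  map_adj : ∀ {X Y : C} (f : X ⟶ Y), map (adj f) = adj (map f)
  d : ∀ X : C, X ⟶ bar (bar X)
  d_unitary : ∀ X : C, IsUnitaryArrow (d X)
  d_natural : ∀ {X Y : C} (f : X ⟶ Y), f ≫ d Y = d X ≫ map (map f)
  map_d : ∀ X : C, map (d X) = d (bar X)
  c : ∀ X Y : C, bar Y ⊗ bar X ⟶ bar (X ⊗ Y)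
  c_unitary : ∀ X Y : C, IsUnitaryArrow (c X Y)
  c_natural : ∀ {X Y X' Y' : C} (f : X ⟶ X') (g : Y ⟶ Y'),
    (map g ⊗ₘ map f) ≫ c X' Y' = c X Y ≫ map (f ⊗ₘ g)
  /-- `c_{Z,YX} ∘ (c_{Y,X} × 1) = c_{ZY,X} ∘ (1 × c_{Z,Y})` -/
  c_assoc : ∀ X Y Z : C,
    c Y X ▷ bar Z ≫ c Z (Y ⊗ X) =
      (α_ (bar X) (bar Y) (bar Z)).hom ≫ bar X ◁ c Z Y ≫ c (Z ⊗ Y) X ≫ map (α_ Z Y X).hom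
  /-- `bar c_{X,Y} ∘ c_{bar Y, bar X} ∘ (d_X × d_Y) = d_{XY}` -/
  c_d : ∀ X Y : C, (d X ⊗ₘ d Y) ≫ c (bar Y) (bar X) ≫ map (c X Y) = d (X ⊗ Y)

/-- The conjugation defined by standard solutions: `(map T × 1_X) ∘ R_X = (1 × T*) ∘ R_Y` for
`T : X → Y`, and `c`, `d` are expressed through `R` and `Rbar`. -/
def FunctorialConjugation.IsDefinedBy {C : Type u} [Category.{v} C] [MonoidalCategory C]
    [TensorCStarCategory C] (S : StandardChoice C) (K : FunctorialConjugation S.bar) : Prop :=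
  (∀ (X Y : C) (T : X ⟶ Y), S.R X ≫ K.map T ▷ X = S.R Y ≫ S.bar Y ◁ adj T) ∧
  (∀ X Y : C, K.c X Y = S.c X Y) ∧ (∀ X : C, K.d X = S.d X)

/-! ### Semilinear tensor C*-categories -/

/-- A semilinear C*-category with given category `C` of linear arrows: the data of the Banach
spaces `AHom X Y` of antilinear arrows and of the compositions and adjoints involving them. All
compositions are written in diagrammatic order: `la f r` is `r ∘ f` with `f` linear and `r`
antilinear, `al r g` is `g ∘ r` with `r` antilinear and `g` linear, and `aa r s` is `s ∘ r` with
`r`, `s` antilinear. -/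
structure SemilinearCStar (C : Type u) [Category.{v} C] [CStarCategory C] where
  AHom : C → C → Type v
  [normed : ∀ X Y : C, NormedAddCommGroup (AHom X Y)]
  [space : ∀ X Y : C, NormedSpace ℂ (AHom X Y)]
  [complete : ∀ X Y : C, CompleteSpace (AHom X Y)]
  la : ∀ {X Y Z : C}, (X ⟶ Y) → AHom Y Z → AHom X Z
  al : ∀ {X Y Z : C}, AHom X Y → (Y ⟶ Z) → AHom X Z
  aa : ∀ {X Y Z : C}, AHom X Y → AHom Y Z → (X ⟶ Z)
  star : ∀ {X Y : C}, AHom X Y → AHom Y X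
  -- composition is biadditive
  la_add_left : ∀ {X Y Z : C} (f g : X ⟶ Y) (r : AHom Y Z), la (f + g) r = la f r + la g r
  la_add_right : ∀ {X Y Z : C} (f : X ⟶ Y) (r s : AHom Y Z), la f (r + s) = la f r + la f s
  al_add_left : ∀ {X Y Z : C} (r s : AHom X Y) (f : Y ⟶ Z), al (r + s) f = al r f + al s f
  al_add_right : ∀ {X Y Z : C} (r : AHom X Y) (f g : Y ⟶ Z), al r (f + g) = al r f + al r g
  aa_add_left : ∀ {X Y Z : C} (r s : AHom X Y) (t : AHom Y Z), aa (r + s) t = aa r t + aa s t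
  aa_add_right : ∀ {X Y Z : C} (r : AHom X Y) (s t : AHom Y Z), aa r (s + t) = aa r s + aa r t
  -- scalars are conjugated when they pass an antilinear arrow
  la_smul : ∀ {X Y Z : C} (a b : ℂ) (f : X ⟶ Y) (r : AHom Y Z),
    la (a • f) (b • r) = (b * conj a) • la f r
  al_smul : ∀ {X Y Z : C} (a b : ℂ) (r : AHom X Y) (f : Y ⟶ Z),
    al (a • r) (b • f) = (b * a) • al r f
  aa_smul : ∀ {X Y Z : C} (a b : ℂ) (r : AHom X Y) (s : AHom Y Z),
    aa (a • r) (b • s) = (b * conj a) • aa r s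
  -- identities and associativity
  id_la : ∀ {X Y : C} (r : AHom X Y), la (𝟙 X) r = r
  al_id : ∀ {X Y : C} (r : AHom X Y), al r (𝟙 Y) = r
  assoc_lla : ∀ {W X Y Z : C} (f : W ⟶ X) (g : X ⟶ Y) (r : AHom Y Z),
    la (f ≫ g) r = la f (la g r)
  assoc_lal : ∀ {W X Y Z : C} (f : W ⟶ X) (r : AHom X Y) (g : Y ⟶ Z),
    al (la f r) g = la f (al r g)
  assoc_all : ∀ {W X Y Z : C} (r : AHom W X) (f : X ⟶ Y) (g : Y ⟶ Z),
    al (al r f) g = al r (f ≫ g)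
  assoc_laa : ∀ {W X Y Z : C} (f : W ⟶ X) (r : AHom X Y) (s : AHom Y Z),
    aa (la f r) s = f ≫ aa r s
  assoc_ala : ∀ {W X Y Z : C} (r : AHom W X) (f : X ⟶ Y) (s : AHom Y Z),
    aa (al r f) s = aa r (la f s)
  assoc_aal : ∀ {W X Y Z : C} (r : AHom W X) (s : AHom X Y) (f : Y ⟶ Z),
    aa r s ≫ f = aa r (al s f)
  assoc_aaa : ∀ {W X Y Z : C} (r : AHom W X) (s : AHom X Y) (t : AHom Y Z),
    la (aa r s) t = al r (aa s t)
  -- the adjoint is a contravariant involution, linear on antilinear arrows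
  star_star : ∀ {X Y : C} (r : AHom X Y), star (star r) = r
  star_add : ∀ {X Y : C} (r s : AHom X Y), star (r + s) = star r + star s
  star_smul : ∀ {X Y : C} (a : ℂ) (r : AHom X Y), star (a • r) = a • star r
  star_la : ∀ {X Y Z : C} (f : X ⟶ Y) (r : AHom Y Z), star (la f r) = al (star r) (adj f)
  star_al : ∀ {X Y Z : C} (r : AHom X Y) (f : Y ⟶ Z), star (al r f) = la (adj f) (star r)
  adj_aa : ∀ {X Y Z : C} (r : AHom X Y) (s : AHom Y Z), adj (aa r s) = aa (star s) (star r)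
  -- norms
  norm_la_le : ∀ {X Y Z : C} (f : X ⟶ Y) (r : AHom Y Z), ‖la f r‖ ≤ ‖f‖ * ‖r‖
  norm_al_le : ∀ {X Y Z : C} (r : AHom X Y) (f : Y ⟶ Z), ‖al r f‖ ≤ ‖r‖ * ‖f‖
  norm_aa_le : ∀ {X Y Z : C} (r : AHom X Y) (s : AHom Y Z), ‖aa r s‖ ≤ ‖r‖ * ‖s‖
  norm_aa_star : ∀ {X Y : C} (r : AHom X Y), ‖aa r (star r)‖ = ‖r‖ ^ 2
  aa_star_positive : ∀ {X Y : C} (r : AHom X Y), ∃ h : X ⟶ X, aa r (star r) = h ≫ adj h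

attribute [instance] SemilinearCStar.normed SemilinearCStar.space SemilinearCStar.complete

/-- An antiunitary arrow: `J* ∘ J = 1` and `J ∘ J* = 1`. -/
def SemilinearCStar.IsAntiunitary {C : Type u} [Category.{v} C] [CStarCategory C]
    (A : SemilinearCStar C) {X Y : C} (J : A.AHom X Y) : Prop :=
  A.aa J (A.star J) = 𝟙 X ∧ A.aa (A.star J) J = 𝟙 Y

/-- A semilinear tensor C*-category with category `C` of linear arrows: the tensor product of
`r : X → Y` and `s : X' → Y'` antilinear is an antilinear arrow `r × s : X X' → Y' Y`. -/
structure SemilinearTensorCStar (C : Type u) [Category.{v} C] [MonoidalCategory C]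
    [TensorCStarCategory C] extends SemilinearCStar C where
  tensor : ∀ {X Y X' Y' : C}, AHom X Y → AHom X' Y' → AHom (X ⊗ X') (Y' ⊗ Y)
  add_tensor : ∀ {X Y X' Y' : C} (r s : AHom X Y) (t : AHom X' Y'),
    tensor (r + s) t = tensor r t + tensor s t
  tensor_add : ∀ {X Y X' Y' : C} (r : AHom X Y) (s t : AHom X' Y'),
    tensor r (s + t) = tensor r s + tensor r t
  smul_tensor : ∀ {X Y X' Y' : C} (a : ℂ) (r : AHom X Y) (s : AHom X' Y'),
    tensor (a • r) s = a • tensor r s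
  tensor_smul : ∀ {X Y X' Y' : C} (a : ℂ) (r : AHom X Y) (s : AHom X' Y'),
    tensor r (a • s) = a • tensor r s
  /-- `(g' × g) ∘ (r × r') = (g ∘ r) × (g' ∘ r')` for `g`, `g'` linear -/
  tensor_al : ∀ {X Y Z X' Y' Z' : C} (r : AHom X Y) (r' : AHom X' Y') (g : Y ⟶ Z) (g' : Y' ⟶ Z'),
    al (tensor r r') (g' ⊗ₘ g) = tensor (al r g) (al r' g')
  /-- `(r × r') ∘ (f × f') = (r ∘ f) × (r' ∘ f')` for `f`, `f'` linear -/
  tensor_la : ∀ {X Y Z X' Y' Z' : C} (f : X ⟶ Y) (f' : X' ⟶ Y') (r : AHom Y Z) (r' : AHom Y' Z'),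
    la (f ⊗ₘ f') (tensor r r') = tensor (la f r) (la f' r')
  /-- `(s' × s) ∘ (r × r') = (s ∘ r) × (s' ∘ r')` for `s`, `s'` antilinear -/
  tensor_aa : ∀ {X Y Z X' Y' Z' : C} (r : AHom X Y) (r' : AHom X' Y') (s : AHom Y Z)
    (s' : AHom Y' Z'), aa (tensor r r') (tensor s' s) = aa r s ⊗ₘ aa r' s'
  /-- `(r × s)* = s* × r*` -/
  star_tensor : ∀ {X Y X' Y' : C} (r : AHom X Y) (s : AHom X' Y'),
    star (tensor r s) = tensor (star s) (star r)
  /-- `(r × s) × t = r × (s × t)` up to the structural isomorphisms -/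
  tensor_assoc : ∀ {X Y X' Y' X'' Y'' : C} (r : AHom X Y) (s : AHom X' Y') (t : AHom X'' Y''),
    al (tensor (tensor r s) t) (α_ Y'' Y' Y).inv = la (α_ X X' X'').hom (tensor r (tensor s t))
  /-- there is an antiunitary unit `e` for the tensor product of antilinear arrows:
  `e × r = r = r × e` up to the structural isomorphisms -/
  exists_unit : ∃ e : AHom (𝟙_ C) (𝟙_ C), toSemilinearCStar.IsAntiunitary e ∧
    ∀ {X Y : C} (r : AHom X Y),
      al (tensor e r) (ρ_ Y).hom = la (λ_ X).hom r ∧ al (tensor r e) (λ_ Y).hom = la (ρ_ X).hom r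

/-- A conjugation on the tensor C*-category `C`: an extension to a semilinear tensor C*-category
with the same objects and linear arrows, where every object is the source of an antiunitary. -/
structure Conjugation (C : Type u) [Category.{v} C] [MonoidalCategory C]
    [TensorCStarCategory C] extends SemilinearTensorCStar C where
  exists_antiunitary : ∀ X : C, ∃ (Y : C) (J : AHom X Y), toSemilinearCStar.IsAntiunitary J

namespace Conjugation

variable {C : Type u} [Category.{v} C] [MonoidalCategory C] [TensorCStarCategory C]

/-- The conjugation `A` is the one associated with the functorial conjugation `K`, through the
antiunitaries `J_X : X → bar X`: `map T = J_Y ∘ T ∘ J_X*` for `T : X → Y`, `d_X = J_{bar X} ∘ J_X`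
and `c_{X,Y} = J_{XY} ∘ (J_X × J_Y)*`. -/
structure IsAssociatedWith (A : Conjugation C) {bar : C → C} (K : FunctorialConjugation bar)
    (J : ∀ X : C, A.AHom X (bar X)) : Prop where
  antiunitary : ∀ X : C, A.IsAntiunitary (J X)
  map_eq : ∀ {X Y : C} (T : X ⟶ Y), K.map T = A.aa (A.star (J X)) (A.la T (J Y))
  d_eq : ∀ X : C, K.d X = A.aa (J X) (J (bar X))
  c_eq : ∀ X Y : C, K.c X Y = A.aa (A.star (A.tensor (J X) (J Y))) (J (X ⊗ Y))

/-- An isomorphism of conjugations on `C`: an isomorphism of the semilinear tensor C*-categories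
that leaves the objects and the linear arrows fixed. -/
structure Iso (A B : Conjugation C) where
  toEquiv : ∀ X Y : C, A.AHom X Y ≃ₗᵢ[ℂ] B.AHom X Y
  map_la : ∀ {X Y Z : C} (f : X ⟶ Y) (r : A.AHom Y Z),
    toEquiv X Z (A.la f r) = B.la f (toEquiv Y Z r)
  map_al : ∀ {X Y Z : C} (r : A.AHom X Y) (f : Y ⟶ Z),
    toEquiv X Z (A.al r f) = B.al (toEquiv X Y r) f
  map_aa : ∀ {X Y Z : C} (r : A.AHom X Y) (s : A.AHom Y Z),
    B.aa (toEquiv X Y r) (toEquiv Y Z s) = A.aa r s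
  map_star : ∀ {X Y : C} (r : A.AHom X Y), toEquiv Y X (A.star r) = B.star (toEquiv X Y r)
  map_tensor : ∀ {X Y X' Y' : C} (r : A.AHom X Y) (s : A.AHom X' Y'),
    toEquiv (X ⊗ X') (Y' ⊗ Y) (A.tensor r s) = B.tensor (toEquiv X Y r) (toEquiv X' Y' s)

end Conjugation

/-! By Frobenius reciprocity, `f ↦ (f × 1) ∘ R` is a bijection from arrows `bar → W` to arrows `ι →
W ⊗ X`. Hence for arbitrary solutions `s` of `X` and `t` of `Y` every `f : X → Y` has a conjugate
`conjMap s t f`, and these compose: `conjMap_comp_conjMap`. All arrows in the theorem are conjugates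
of identities between different solutions: `c` compares the product solution with the chosen one,
`d` the reversed solution with the chosen one, `U` two choices. So naturality, coherence and
independence of choices are formal.

The analytic point is that conjugation commutes with the adjoint, which also makes `c`, `d` and `U`
unitary. This holds when the traces `R* (1 × T) R` and `Rbar* (T × 1) Rbar` agree (`conjMap_adj`).
Standard solutions have this property: minimal projections compress `T` to scalars and the
normalization gives both traces the same weights (`IsStandard.isSpherical`). It passes to reversed
and product solutions.

The functor yields a conjugation on letting `bar X → Y` be the space of antilinear arrows `X → Y`,
with `T` standing for `T ∘ J_X`. Conversely, in any associated conjugation each antilinear arrow is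
uniquely `f ∘ J_X`, and the functorial data determine every operation on such arrows; this gives the
unique isomorphism.

For existence, a Bessel estimate makes `(X, X)` finite-dimensional, so `1_X` is a sum of minimal
projections. Their conjugates for an arbitrary solution are orthogonal idempotents, simultaneously
similar to projections. Twisting the solution by the similarity and then rescaling each summand
makes it standard. -/

/-! ### Linear structure -/

namespace CStarCategory

section Linear

variable {C : Type u} [Category.{v} C] [CStarCategory C]

/-- The preadditive structure underlying a C*-category. -/
abbrev preadditive : Preadditive C where
  homGroup _ _ := inferInstance
  add_comp _ _ _ f f' g := add_comp f f' g
  comp_add _ _ _ f g g' := comp_add f g g'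

attribute [local instance] preadditive

/-- The linear structure underlying a C*-category. -/
abbrev linear : Linear ℂ C where
  homModule _ _ := inferInstance
  smul_comp _ _ _ a f g := smul_comp a f g
  comp_smul _ _ _ f a g := comp_smul a f g

theorem adj_id (X : C) : adj (𝟙 X) = 𝟙 X := by
  have h := adj_comp (adj (𝟙 X)) (𝟙 X)
  rw [Category.comp_id, adj_adj, Category.comp_id] at h
  exact h.symm

theorem adj_zero {X Y : C} : adj (0 : X ⟶ Y) = 0 := by
  simpa using adj_smul (0 : ℂ) (0 : X ⟶ Y)

theorem adj_neg {X Y : C} (f : X ⟶ Y) : adj (-f) = -adj f := by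
  simpa using adj_smul (-1 : ℂ) f

theorem adj_sub {X Y : C} (f g : X ⟶ Y) : adj (f - g) = adj f - adj g := by
  rw [sub_eq_add_neg, adj_add, adj_neg, ← sub_eq_add_neg]

theorem adj_sum {X Y : C} {ι : Type*} (s : Finset ι) (f : ι → (X ⟶ Y)) :
    adj (∑ i ∈ s, f i) = ∑ i ∈ s, adj (f i) :=
  map_sum (AddMonoidHom.mk' (adj : (X ⟶ Y) → (Y ⟶ X)) adj_add) f s

theorem adj_injective {X Y : C} : Function.Injective (adj : (X ⟶ Y) → (Y ⟶ X)) :=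
  Function.LeftInverse.injective adj_adj

theorem norm_adj {X Y : C} (f : X ⟶ Y) : ‖adj f‖ = ‖f‖ := by
  have key : ∀ {X Y : C} (f : X ⟶ Y), ‖f‖ ≤ ‖adj f‖ := by
    intro X Y f
    have h := norm_comp_le f (adj f)
    rw [norm_comp_adj, sq] at h
    by_contra! hlt
    have := norm_nonneg (adj f)
    nlinarith
  exact le_antisymm (by simpa [adj_adj] using key (adj f)) (key f)

theorem eq_zero_of_comp_adj {X Y : C} {f : X ⟶ Y} (h : f ≫ adj f = 0) : f = 0 := by
  have := norm_comp_adj f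
  rw [h, norm_zero] at this
  exact norm_eq_zero.mp (pow_eq_zero_iff (two_ne_zero) |>.mp this.symm)

theorem norm_id_le (X : C) : ‖𝟙 X‖ ≤ 1 := by
  have := norm_comp_adj (𝟙 X)
  rw [adj_id, Category.comp_id] at this
  nlinarith [norm_nonneg (𝟙 X)]

theorem norm_le_one_of_comp_adj {X Y : C} {f : X ⟶ Y} (h : f ≫ adj f = 𝟙 X) : ‖f‖ ≤ 1 := by
  have := norm_comp_adj f
  rw [h] at this
  nlinarith [norm_id_le X, norm_nonneg f]

theorem norm_adj_comp {X Y : C} (f : X ⟶ Y) : ‖adj f ≫ f‖ = ‖f‖ * ‖f‖ := by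
  have := norm_comp_adj (adj f)
  rwa [adj_adj, norm_adj, sq] at this

theorem smul_id_comp {X Y : C} (a : ℂ) (f : X ⟶ Y) : (a • 𝟙 X) ≫ f = a • f := by
  rw [CStarCategory.smul_comp, Category.id_comp]

theorem comp_smul_id {X Y : C} (a : ℂ) (f : X ⟶ Y) : f ≫ (a • 𝟙 Y) = a • f := by
  rw [CStarCategory.comp_smul, Category.comp_id]

theorem smul_id_comp_smul_id (a b : ℂ) (X : C) : (a • 𝟙 X) ≫ (b • 𝟙 X) = (a * b) • 𝟙 X := by
  rw [smul_id_comp, mul_smul]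

/-! ### Endomorphisms of an object as a C*-algebra. -/

variable (C) in
/-- The algebra of endomorphisms of `X`, with diagrammatic composition as product. -/
def EndAlg (X : C) : Type v := X ⟶ X

noncomputable instance (X : C) : NormedAddCommGroup (EndAlg C X) :=
  inferInstanceAs (NormedAddCommGroup (X ⟶ X))

noncomputable instance (X : C) : NormedSpace ℂ (EndAlg C X) :=
  inferInstanceAs (NormedSpace ℂ (X ⟶ X))

instance (X : C) : CompleteSpace (EndAlg C X) :=
  inferInstanceAs (CompleteSpace (X ⟶ X))

instance (X : C) : Monoid (EndAlg C X) where
  mul f g := (f : X ⟶ X) ≫ (g : X ⟶ X)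
  one := 𝟙 X
  mul_assoc := fun f g h => Category.assoc (f : X ⟶ X) g h
  one_mul := fun f => Category.id_comp (f : X ⟶ X)
  mul_one := fun f => Category.comp_id (f : X ⟶ X)

noncomputable instance (X : C) : NormedRing (EndAlg C X) where
  __ := (inferInstance : NormedAddCommGroup (EndAlg C X))
  __ := (inferInstance : Monoid (EndAlg C X))
  left_distrib := fun f g h => CStarCategory.comp_add (f : X ⟶ X) g h
  right_distrib := fun f g h => CStarCategory.add_comp (f : X ⟶ X) g h
  zero_mul := fun f => Limits.zero_comp (f := (f : X ⟶ X))
  mul_zero := fun f => Limits.comp_zero (f := (f : X ⟶ X))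
  norm_mul_le := fun f g => CStarCategory.norm_comp_le (f : X ⟶ X) g

noncomputable instance (X : C) : StarRing (EndAlg C X) where
  star f := adj (f : X ⟶ X)
  star_involutive f := adj_adj (f : X ⟶ X)
  star_mul f g := adj_comp (f : X ⟶ X) g
  star_add f g := adj_add (f : X ⟶ X) g

noncomputable instance (X : C) : CStarAlgebra (EndAlg C X) where
  __ := (inferInstance : NormedRing (EndAlg C X))
  __ := (inferInstance : StarRing (EndAlg C X))
  __ := (inferInstance : CompleteSpace (EndAlg C X))
  norm_mul_self_le f := (norm_adj_comp (f : X ⟶ X)).ge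
  algebraMap :=
    { toFun := fun a => a • (1 : EndAlg C X)
      map_one' := one_smul _ _
      map_mul' := fun a b => (smul_id_comp_smul_id a b X).symm
      map_zero' := zero_smul _ _
      map_add' := fun a b => add_smul a b _ }
  smul := fun a f => a • f
  commutes' := fun a f => (smul_id_comp a (f : X ⟶ X)).trans (comp_smul_id a (f : X ⟶ X)).symm
  smul_def' := fun a f => (smul_id_comp a (f : X ⟶ X)).symm
  norm_smul_le := fun a f => (norm_smul a (f : X ⟶ X)).le
  star_smul a f := adj_smul a (f : X ⟶ X)

end Linear

end CStarCategory

/-! ### Adjoints and linearity of the tensor product. -/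

namespace TensorCStarCategory

open CStarCategory

attribute [local instance] preadditive linear

variable {C : Type u} [Category.{v} C] [MonoidalCategory C] [TensorCStarCategory C]

theorem monoidalPreadditive : MonoidalPreadditive C where
  whiskerLeft_zero {X Y Z} := by
    rw [← id_tensorHom]; simpa using tensor_smul (0 : ℂ) (𝟙 X) (0 : Y ⟶ Z)
  zero_whiskerRight {X Y Z} := by
    rw [← tensorHom_id]; simpa using smul_tensor (0 : ℂ) (0 : Y ⟶ Z) (𝟙 X)
  whiskerLeft_add f g := by simp only [← id_tensorHom, tensor_add]
  add_whiskerRight f g := by simp only [← tensorHom_id, add_tensor]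

attribute [local instance] monoidalPreadditive

theorem monoidalLinear : MonoidalLinear ℂ C where
  whiskerLeft_smul X _ _ a f := by simp only [← id_tensorHom, tensor_smul]
  smul_whiskerRight a _ _ f X := by simp only [← tensorHom_id, smul_tensor]

theorem adj_whiskerLeft (X : C) {Y Z : C} (f : Y ⟶ Z) : adj (X ◁ f) = X ◁ adj f := by
  simp only [← id_tensorHom, adj_tensor, adj_id]

theorem adj_whiskerRight {Y Z : C} (f : Y ⟶ Z) (X : C) : adj (f ▷ X) = adj f ▷ X := by
  simp only [← tensorHom_id, adj_tensor, adj_id]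

theorem adj_associator_inv (X Y Z : C) : adj (α_ X Y Z).inv = (α_ X Y Z).hom := by
  rw [← adj_associator, adj_adj]

theorem adj_leftUnitor_inv (X : C) : adj (λ_ X).inv = (λ_ X).hom := by
  rw [← adj_leftUnitor, adj_adj]

theorem adj_rightUnitor_inv (X : C) : adj (ρ_ X).inv = (ρ_ X).hom := by
  rw [← adj_rightUnitor, adj_adj]

end TensorCStarCategory

section

set_option linter.unusedSectionVars false

open CStarCategory TensorCStarCategory

attribute [local instance] CStarCategory.preadditive CStarCategory.linear
  TensorCStarCategory.monoidalPreadditive TensorCStarCategory.monoidalLinear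

/-! ### Transposition with respect to solutions of the conjugate equations -/

namespace ConjugateSolution

variable {C : Type u} [Category.{v} C] [MonoidalCategory C] [TensorCStarCategory C]

section Transpose

variable {X Y Z : C} (s : ConjugateSolution X) (t : ConjugateSolution Y) (w : ConjugateSolution Z)

/-- The same solution, regarded as a solution for the conjugate. -/
abbrev rev : ConjugateSolution s.bar where
  bar := X
  R := s.Rbar
  Rbar := s.R
  conj_eq := s.conj_eq_bar
  conj_eq_bar := s.conj_eq

/-- A solution of the conjugate equations is an exact pairing. -/
abbrev pairing : ExactPairing s.bar X where
  coevaluation' := s.R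
  evaluation' := adj s.Rbar
  coevaluation_evaluation' := by
    have h := s.conj_eq
    rw [Iso.inv_comp_eq, Category.comp_id] at h
    rw [← h]
    simp
  evaluation_coevaluation' := by
    -- This triangle identity involves `R` and `Rbar*`, the second conjugate equation `R*` and
    -- `Rbar`: they are adjoint to each other.
    have h := congrArg adj s.conj_eq_bar
    simp only [adj_comp, adj_id, adj_leftUnitor, adj_rightUnitor_inv, adj_whiskerLeft,
      adj_whiskerRight, adj_adj, adj_associator_inv, Category.assoc, Iso.inv_comp_eq,
      Category.comp_id] at h
    rw [← h]
    simp

theorem snake_coev : s.R ▷ s.bar ⊗≫ s.bar ◁ adj s.Rbar = ⊗𝟙.hom := by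
  let _ := s.pairing
  exact ExactPairing.evaluation_coevaluation'' (X := s.bar) (Y := X)

theorem snake_ev : X ◁ s.R ⊗≫ adj s.Rbar ▷ X = ⊗𝟙.hom := by
  let _ := s.pairing
  exact ExactPairing.coevaluation_evaluation'' (X := s.bar) (Y := X)

/-- The arrow `f : bar → W` with `(f × 1) ∘ R = g`. -/
def unname {W : C} (g : 𝟙_ C ⟶ W ⊗ X) : s.bar ⟶ W :=
  (λ_ s.bar).inv ≫ g ▷ s.bar ≫ (α_ W X s.bar).hom ≫ W ◁ adj s.Rbar ≫ (ρ_ W).hom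

/-- Existence half of Frobenius reciprocity, by sliding `g` past `R` and straightening the zigzag;
`unname_R` is the uniqueness half. -/
theorem R_unname {W : C} (g : 𝟙_ C ⟶ W ⊗ X) : s.R ≫ s.unname g ▷ X = g := by
  calc
    _ = 𝟙 _ ⊗≫ (𝟙_ C ◁ s.R ≫ g ▷ (s.bar ⊗ X)) ⊗≫ W ◁ adj s.Rbar ▷ X ⊗≫ 𝟙 _ := by
      rw [unname]; monoidal
    _ = g ⊗≫ W ◁ (X ◁ s.R ⊗≫ adj s.Rbar ▷ X) ⊗≫ 𝟙 _ := by
      rw [whisker_exchange]; monoidal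
    _ = g := by rw [snake_ev]; monoidal

theorem unname_R {W : C} (f : s.bar ⟶ W) : s.unname (s.R ≫ f ▷ X) = f := by
  calc
    _ = 𝟙 _ ⊗≫ s.R ▷ s.bar ⊗≫ (f ▷ (X ⊗ s.bar) ≫ W ◁ adj s.Rbar) ⊗≫ 𝟙 _ := by
      rw [unname]; monoidal
    _ = 𝟙 _ ⊗≫ (s.R ▷ s.bar ⊗≫ s.bar ◁ adj s.Rbar) ⊗≫ f := by
      rw [← whisker_exchange]; monoidal
    _ = f := by rw [snake_coev]; monoidal

theorem hom_ext {W : C} {f g : s.bar ⟶ W} (h : s.R ≫ f ▷ X = s.R ≫ g ▷ X) : f = g := by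
  rw [← s.unname_R f, h, unname_R]

theorem whiskerLeft_unname_comp_adj {W : C} (h : X ⊗ W ⟶ 𝟙_ C) :
    X ◁ ((λ_ W).inv ≫ s.R ▷ W ≫ (α_ s.bar X W).hom ≫ s.bar ◁ h ≫ (ρ_ s.bar).hom) ≫ adj s.Rbar =
      h := by
  calc
    _ = 𝟙 _ ⊗≫ X ◁ s.R ▷ W ⊗≫ ((X ⊗ s.bar) ◁ h ≫ adj s.Rbar ▷ 𝟙_ C) ⊗≫ 𝟙 _ := by monoidal
    _ = 𝟙 _ ⊗≫ (X ◁ s.R ⊗≫ adj s.Rbar ▷ X) ▷ W ⊗≫ h := by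
      rw [whisker_exchange]; monoidal
    _ = h := by rw [snake_ev]; monoidal

/-- The conjugate of an arrow: `(conjMap f × 1) ∘ R_X = (1 × f*) ∘ R_Y`. -/
def conjMap (f : X ⟶ Y) : s.bar ⟶ t.bar :=
  s.unname (t.R ≫ t.bar ◁ adj f)

variable {s t}

theorem R_conjMap (f : X ⟶ Y) : s.R ≫ conjMap s t f ▷ X = t.R ≫ t.bar ◁ adj f :=
  s.R_unname _

theorem eq_conjMap {f : X ⟶ Y} {g : s.bar ⟶ t.bar}
    (h : s.R ≫ g ▷ X = t.R ≫ t.bar ◁ adj f) : g = conjMap s t f :=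
  s.hom_ext (h.trans (R_conjMap f).symm)

/-- This is the defining equation of a conjugate for the reversed solutions, so conjugating back
returns `f` (`rev_conjMap`) and `conjMap` is bijective. No sphericality is needed. -/
theorem Rbar_adj_conjMap (f : X ⟶ Y) :
    t.Rbar ≫ Y ◁ adj (conjMap s t f) = s.Rbar ≫ f ▷ s.bar := by
  apply adj_injective
  rw [adj_comp, adj_comp, adj_whiskerLeft, adj_whiskerRight, adj_adj]
  rw [← t.whiskerLeft_unname_comp_adj (adj f ▷ s.bar ≫ adj s.Rbar)]
  congr 2
  rw [conjMap, unname]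
  monoidal

variable (s t)

theorem rev_conjMap (f : X ⟶ Y) : conjMap s.rev t.rev (conjMap s t f) = f :=
  (eq_conjMap (s := s.rev) (t := t.rev) (Rbar_adj_conjMap f).symm).symm

/-- The three solutions are arbitrary, even over the same object. With identity arrows this is the
calculus behind all the coherence identities below. -/
theorem conjMap_comp_conjMap (f : X ⟶ Y) (g : Y ⟶ Z) :
    conjMap s t f ≫ conjMap t w g = conjMap s w (f ≫ g) := by
  apply eq_conjMap
  rw [comp_whiskerRight, reassoc_of% R_conjMap (s := s) (t := t) f, whisker_exchange,
    reassoc_of% R_conjMap (s := t) (t := w) g, adj_comp, whiskerLeft_comp]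

theorem conjMap_id : conjMap s s (𝟙 X) = 𝟙 s.bar :=
  (eq_conjMap (by simp [adj_id])).symm

theorem conjMap_add (f g : X ⟶ Y) : conjMap s t (f + g) = conjMap s t f + conjMap s t g :=
  (eq_conjMap (by simp [adj_add, R_conjMap])).symm

theorem conjMap_smul (a : ℂ) (f : X ⟶ Y) : conjMap s t (a • f) = conj a • conjMap s t f :=
  (eq_conjMap (by simp [adj_smul, R_conjMap])).symm

theorem conjMap_neg (f : X ⟶ Y) : conjMap s t (-f) = -conjMap s t f := by
  simpa using conjMap_smul s t (-1) f

theorem conjMap_sub (f g : X ⟶ Y) : conjMap s t (f - g) = conjMap s t f - conjMap s t g := by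
  rw [sub_eq_add_neg, conjMap_add, conjMap_neg, ← sub_eq_add_neg]

theorem conjMap_zero : conjMap s t (0 : X ⟶ Y) = 0 := by
  simpa using conjMap_smul s t 0 (0 : X ⟶ Y)

theorem exists_conjMap_eq (g : s.bar ⟶ t.bar) : ∃ f, conjMap s t f = g :=
  ⟨_, rev_conjMap s.rev t.rev g⟩

end Transpose

/-! ### Products of solutions -/

/-- The arrow `(1 × f × 1) ∘ g`. -/
def nest {W X Z Y : C} (f : 𝟙_ C ⟶ W ⊗ X) (g : 𝟙_ C ⟶ Z ⊗ Y) : 𝟙_ C ⟶ (Z ⊗ W) ⊗ (X ⊗ Y) :=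
  g ≫ Z ◁ ((λ_ Y).inv ≫ f ▷ Y ≫ (α_ W X Y).hom) ≫ (α_ Z W (X ⊗ Y)).inv

theorem nest_eq {W X Z Y : C} (f : 𝟙_ C ⟶ W ⊗ X) (g : 𝟙_ C ⟶ Z ⊗ Y) :
    nest f g = g ⊗≫ (Z ◁ f) ▷ Y ⊗≫ 𝟙 _ := by
  rw [nest]; monoidal

theorem adj_nest {W X Z Y : C} (f : 𝟙_ C ⟶ W ⊗ X) (g : 𝟙_ C ⟶ Z ⊗ Y) :
    adj (nest f g) = (α_ Z W (X ⊗ Y)).hom ≫ Z ◁ ((α_ W X Y).inv ≫ adj f ▷ Y ≫ (λ_ Y).hom) ≫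
      adj g := by
  simp only [nest, adj_comp, adj_whiskerLeft, adj_whiskerRight, adj_associator_inv,
    adj_associator, adj_leftUnitor_inv, Category.assoc]

theorem nest_comp {W X Z Y W' X' Z' Y' : C} (f : 𝟙_ C ⟶ W ⊗ X) (g : 𝟙_ C ⟶ Z ⊗ Y)
    (a : W ⟶ W') (b : X ⟶ X') (c : Z ⟶ Z') (d : Y ⟶ Y') :
    nest f g ≫ ((c ⊗ₘ a) ⊗ₘ (b ⊗ₘ d)) = nest (f ≫ (a ⊗ₘ b)) (g ≫ (c ⊗ₘ d)) := by
  have h : ((λ_ Y).inv ≫ f ▷ Y ≫ (α_ W X Y).hom) ≫ (a ⊗ₘ (b ⊗ₘ d)) =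
      d ≫ (λ_ Y').inv ≫ (f ≫ (a ⊗ₘ b)) ▷ Y' ≫ (α_ W' X' Y').hom := by
    rw [Category.assoc, Category.assoc, ← associator_naturality, leftUnitor_inv_naturality_assoc,
      whisker_exchange_assoc, comp_whiskerRight, MonoidalCategory.tensorHom_def (a ⊗ₘ b) d]
    simp only [Category.assoc]
  simp only [nest, Category.assoc]
  rw [← associator_inv_naturality, ← id_tensorHom, tensorHom_comp_tensorHom_assoc, Category.id_comp,
    h, MonoidalCategory.tensorHom_def c d]
  simp only [Category.assoc, ← whiskerLeft_comp_assoc, MonoidalCategory.tensorHom_def c]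

theorem nest_assoc {W X Z Y U V : C} (f : 𝟙_ C ⟶ W ⊗ X) (g : 𝟙_ C ⟶ Z ⊗ Y) (h : 𝟙_ C ⟶ U ⊗ V) :
    nest (nest f g) h ≫ (α_ U Z W).inv ▷ ((X ⊗ Y) ⊗ V) =
      nest f (nest g h) ≫ ((U ⊗ Z) ⊗ W) ◁ (α_ X Y V).inv := by
  simp only [nest]
  monoidal

section Products

variable {X Y Z X' Y' : C} (s : ConjugateSolution X) (t : ConjugateSolution Y)

/-- Exact pairings multiply, and the nested arrows are the coevaluation and evaluation of the
product. The other conjugate equation is this one for the reversed solutions in the opposite order.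
-/
theorem nest_conj_eq :
    (ρ_ (X ⊗ Y)).inv ≫ (X ⊗ Y) ◁ nest s.R t.R ≫ (α_ (X ⊗ Y) (t.bar ⊗ s.bar) (X ⊗ Y)).inv ≫
      adj (nest t.Rbar s.Rbar) ▷ (X ⊗ Y) ≫ (λ_ (X ⊗ Y)).hom = 𝟙 (X ⊗ Y) := by
  let _ := s.pairing
  let _ := t.pairing
  have h := ExactPairing.coevaluation_evaluation (t.bar ⊗ s.bar) (X ⊗ Y)
  have h₁ : η_ (t.bar ⊗ s.bar) (X ⊗ Y) = nest s.R t.R := (nest_eq ..).symm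
  have h₂ : ε_ (t.bar ⊗ s.bar) (X ⊗ Y) = adj (nest t.Rbar s.Rbar) := by
    rw [adj_nest]
    change 𝟙 _ ⊗≫ X ◁ (adj t.Rbar ▷ s.bar) ⊗≫ adj s.Rbar = _
    monoidal
  rw [h₁, h₂] at h
  simp only [reassoc_of% h, Iso.inv_hom_id_assoc, Iso.inv_hom_id]

/-- The product of two solutions. -/
abbrev tensor : ConjugateSolution (X ⊗ Y) where
  bar := t.bar ⊗ s.bar
  R := nest s.R t.R
  Rbar := nest t.Rbar s.Rbar
  conj_eq := nest_conj_eq s t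
  conj_eq_bar := nest_conj_eq t.rev s.rev

-- In a nested solution the inner and the outer pair do not interact, so each factor can be
-- conjugated separately.
variable {s t} in
theorem conjMap_tensor {s' : ConjugateSolution X'} {t' : ConjugateSolution Y'} (f : X ⟶ X')
    (g : Y ⟶ Y') :
    conjMap (tensor s t) (tensor s' t') (f ⊗ₘ g) = conjMap t t' g ⊗ₘ conjMap s s' f := by
  refine (eq_conjMap ?_).symm
  have h := nest_comp s.R t.R (conjMap s s' f) (𝟙 X) (conjMap t t' g) (𝟙 Y)
  have h' := nest_comp s'.R t'.R (𝟙 _) (adj f) (𝟙 _) (adj g)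
  simp only [tensorHom_id, id_tensorHom, R_conjMap, id_whiskerRight] at h h'
  rw [adj_tensor]
  exact h.trans h'.symm

theorem conjMap_associator (w : ConjugateSolution Z) :
    conjMap (tensor (tensor s t) w) (tensor s (tensor t w)) (α_ X Y Z).hom =
      (α_ w.bar t.bar s.bar).inv := by
  refine (eq_conjMap ?_).symm
  rw [adj_associator]
  exact nest_assoc ..

variable (C) in
/-- The trivial solution for the tensor unit. -/
abbrev unit : ConjugateSolution (𝟙_ C) where
  bar := 𝟙_ C
  R := (λ_ (𝟙_ C)).inv
  Rbar := (λ_ (𝟙_ C)).inv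
  conj_eq := by rw [adj_leftUnitor_inv]; monoidal
  conj_eq_bar := by rw [adj_leftUnitor_inv]; monoidal

theorem conjMap_leftUnitor :
    conjMap (tensor (unit C) s) s (λ_ X).hom = (ρ_ s.bar).hom := by
  refine (eq_conjMap ?_).symm
  rw [adj_leftUnitor]
  change nest (λ_ (𝟙_ C)).inv s.R ≫ _ = _
  rw [nest]
  monoidal

theorem conjMap_rightUnitor :
    conjMap (tensor s (unit C)) s (ρ_ X).hom = (λ_ s.bar).hom := by
  refine (eq_conjMap ?_).symm
  rw [adj_rightUnitor]
  change nest s.R (λ_ (𝟙_ C)).inv ≫ _ = _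
  rw [nest]
  monoidal

end Products

end ConjugateSolution

/-! ### Spherical solutions -/

section Unit

variable {C : Type u} [Category.{v} C] [MonoidalCategory C] [TensorCStarCategory C]

theorem HasIrreducibleUnit.norm_id (hunit : HasIrreducibleUnit C) : ‖𝟙 (𝟙_ C)‖ = 1 := by
  have h := norm_comp_adj (𝟙 (𝟙_ C))
  rw [adj_id, Category.comp_id] at h
  have h0 := norm_pos_iff.mpr hunit.1
  nlinarith

/-- Positivity is essential here: the C*-identity alone determines the scalar only up to sign. -/
theorem HasIrreducibleUnit.comp_adj_eq (hunit : HasIrreducibleUnit C) {Z : C} (x : 𝟙_ C ⟶ Z) :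
    x ≫ adj x = ((‖x‖ ^ 2 : ℝ) : ℂ) • 𝟙 (𝟙_ C) := by
  obtain ⟨h, hh⟩ := comp_adj_positive x
  obtain ⟨a, rfl⟩ := hunit.2 h
  have h2 : x ≫ adj x = ((‖a‖ ^ 2 : ℝ) : ℂ) • 𝟙 (𝟙_ C) := by
    rw [hh, adj_smul, adj_id, smul_id_comp_smul_id, Complex.mul_conj, Complex.normSq_eq_norm_sq]
  have h3 := norm_comp_adj x
  rw [h2, norm_smul, hunit.norm_id, mul_one, Complex.norm_real, Real.norm_of_nonneg (sq_nonneg _)] at h3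
  rw [h2, h3]

theorem HasIrreducibleUnit.smul_injective (hunit : HasIrreducibleUnit C) :
    Function.Injective fun a : ℂ => a • 𝟙 (𝟙_ C) :=
  smul_left_injective ℂ hunit.1

theorem HasIrreducibleUnit.eq_zero_of_comp_adj_eq_neg (hunit : HasIrreducibleUnit C) {Z W : C}
    {x : 𝟙_ C ⟶ Z} {y : 𝟙_ C ⟶ W} (h : x ≫ adj x = -(y ≫ adj y)) : x = 0 := by
  rw [hunit.comp_adj_eq, hunit.comp_adj_eq, ← neg_smul] at h
  have h := hunit.smul_injective h
  rw [← Complex.ofReal_neg, Complex.ofReal_inj] at h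
  have : ‖x‖ = 0 := by nlinarith [sq_nonneg ‖x‖, sq_nonneg ‖y‖]
  exact norm_eq_zero.mp this

end Unit

namespace ConjugateSolution

variable {C : Type u} [Category.{v} C] [MonoidalCategory C] [TensorCStarCategory C]
  {X Y Z : C} {s : ConjugateSolution X} {t : ConjugateSolution Y}

/-- The functional `T ↦ R* ∘ (1 × T) ∘ R`. -/
def trace (s : ConjugateSolution X) (T : X ⟶ X) : 𝟙_ C ⟶ 𝟙_ C :=
  s.R ≫ s.bar ◁ T ≫ adj s.R

/-- The functional `T ↦ Rbar* ∘ (T × 1) ∘ Rbar`. -/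
def trace' (s : ConjugateSolution X) (T : X ⟶ X) : 𝟙_ C ⟶ 𝟙_ C :=
  s.Rbar ≫ T ▷ s.bar ≫ adj s.Rbar

/-- The functionals given by `R` and by `Rbar` agree. -/
def IsSpherical (s : ConjugateSolution X) : Prop :=
  ∀ T : X ⟶ X, s.trace T = s.trace' T

theorem trace_comp_adj {W : C} (s : ConjugateSolution X) (f : X ⟶ W) :
    s.trace (f ≫ adj f) = (s.R ≫ s.bar ◁ f) ≫ adj (s.R ≫ s.bar ◁ f) := by
  simp [trace, adj_comp, adj_whiskerLeft]

theorem trace_sub (s : ConjugateSolution X) (f g : X ⟶ X) :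
    s.trace (f - g) = s.trace f - s.trace g := by
  have : s.bar ◁ (f - g) = s.bar ◁ f - s.bar ◁ g := (tensorLeft s.bar).map_sub
  simp [trace, this, Preadditive.comp_sub, Preadditive.sub_comp]

theorem trace_neg (s : ConjugateSolution X) (f : X ⟶ X) : s.trace (-f) = -s.trace f := by
  have h := s.trace_sub 0 f
  simpa [trace] using h

/-- With `trace_comp_adj` this makes the trace faithful. -/
theorem R_whiskerLeft_eq_zero {W : C} {f : X ⟶ W} (h : s.R ≫ s.bar ◁ f = 0) : f = 0 := by
  have : X ◁ (s.R ≫ s.bar ◁ f) = 0 := by rw [h]; exact MonoidalPreadditive.whiskerLeft_zero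
  calc
    f = 𝟙 _ ⊗≫ (X ◁ s.R ⊗≫ adj s.Rbar ▷ X) ⊗≫ f := by rw [snake_ev]; monoidal
    _ = 𝟙 _ ⊗≫ X ◁ s.R ⊗≫ (adj s.Rbar ▷ X ≫ 𝟙_ C ◁ f) ⊗≫ 𝟙 _ := by monoidal
    _ = 𝟙 _ ⊗≫ X ◁ (s.R ≫ s.bar ◁ f) ⊗≫ adj s.Rbar ▷ W ⊗≫ 𝟙 _ := by
      rw [← whisker_exchange]; monoidal
    _ = 0 := by rw [this]; simp [monoidalComp]

/-- The arrow `h` would be `f` if conjugation commuted with the adjoint. In general the trace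
property holds with `h` in place of `f`. -/
theorem trace_comp_adj_eq_of_conjMap {f h g : X ⟶ Y}
    (hh : conjMap s t h = adj (conjMap t s (adj f))) :
    s.trace (g ≫ adj f) = t.trace (adj h ≫ g) := by
  have h₁ : s.R ≫ s.bar ◁ f = t.R ≫ conjMap t s (adj f) ▷ Y := by
    rw [R_conjMap, adj_adj]
  have h₂ : s.bar ◁ adj f ≫ adj s.R = conjMap s t h ▷ Y ≫ adj t.R := by
    have := congrArg adj h₁
    simpa only [adj_comp, adj_whiskerLeft, adj_whiskerRight, hh] using this
  rw [trace, whiskerLeft_comp, Category.assoc, h₂, whisker_exchange_assoc,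
    reassoc_of% R_conjMap (s := s) (t := t) h, trace, whiskerLeft_comp, Category.assoc]

theorem trace'_comp_adj_eq_of_conjMap {f k g : X ⟶ Y}
    (hk : conjMap s t f = adj (conjMap t s (adj k))) :
    s.trace' (g ≫ adj f) = t.trace' (adj k ≫ g) := by
  have h₁ := congrArg adj (Rbar_adj_conjMap (s := s) (t := t) f)
  simp only [adj_comp, adj_whiskerLeft, adj_whiskerRight, adj_adj] at h₁
  have h₂ := Rbar_adj_conjMap (s := t) (t := s) (adj k)
  rw [← hk] at h₂
  rw [trace', comp_whiskerRight, Category.assoc, ← h₁, ← whisker_exchange_assoc,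
    reassoc_of% h₂, trace', comp_whiskerRight, Category.assoc]

/-- The twisted trace property gives that the trace of `f* f` is minus that of `f f*`, while both
are positive. -/
theorem eq_zero_of_conjMap_eq_neg (hunit : HasIrreducibleUnit C) {f : X ⟶ Y}
    (h : conjMap s t (-f) = adj (conjMap t s (adj f))) : f = 0 := by
  apply R_whiskerLeft_eq_zero (s := s)
  refine hunit.eq_zero_of_comp_adj_eq_neg (y := t.R ≫ t.bar ◁ adj f) ?_
  rw [← trace_comp_adj, ← trace_comp_adj, trace_comp_adj_eq_of_conjMap h, adj_neg, adj_adj,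
    Preadditive.neg_comp, trace_neg]

/-- For spherical solutions, conjugation of arrows commutes with the adjoint. -/
theorem conjMap_adj (hunit : HasIrreducibleUnit C) (hs : s.IsSpherical) (ht : t.IsSpherical)
    (f : X ⟶ Y) : conjMap t s (adj f) = adj (conjMap s t f) := by
  -- Let `A` be the linear bijection of `(X, Y)` with `conj (A f) = (conj (f*))*`. Then `h = A f`
  -- and `k = A⁻¹ f`, and the goal is `A f = f`.
  obtain ⟨h, hh⟩ := exists_conjMap_eq s t (adj (conjMap t s (adj f)))
  obtain ⟨k', hk⟩ := exists_conjMap_eq t s (adj (conjMap s t f))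
  obtain ⟨k, rfl⟩ : ∃ k, adj k = k' := ⟨_, adj_adj k'⟩
  have hk' : conjMap s t f = adj (conjMap t s (adj k)) := by rw [hk, adj_adj]
  -- Moving `f*` around with `R` produces `h`, with `Rbar` it produces `k`. The traces agree, so
  -- faithfulness gives `h = k`, that is, `A² f = f`.
  have key : ∀ g : X ⟶ Y, t.trace (adj h ≫ g) = t.trace (adj k ≫ g) := fun g => by
    rw [← trace_comp_adj_eq_of_conjMap hh, hs, trace'_comp_adj_eq_of_conjMap hk', ht]
  have hhk : adj h - adj k = 0 := by
    apply R_whiskerLeft_eq_zero (s := t)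
    apply eq_zero_of_comp_adj
    rw [← trace_comp_adj, Preadditive.sub_comp, trace_sub, key, sub_self]
  have hhk' : h = k := adj_injective (sub_eq_zero.mp hhk)
  subst hhk'
  -- Now `A (f - h) = -(f - h)`, and `-1` is not an eigenvalue of `A`.
  have h0 : f - h = 0 := by
    refine eq_zero_of_conjMap_eq_neg hunit (s := s) (t := t) ?_
    rw [adj_sub, conjMap_sub, adj_sub, ← hh, ← hk', neg_sub, conjMap_sub]
  rw [← sub_eq_zero.mp h0] at hh
  rw [hh, adj_adj]

theorem conjMap_one_unitary (hunit : HasIrreducibleUnit C) {s t : ConjugateSolution X}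
    (hs : s.IsSpherical) (ht : t.IsSpherical) : IsUnitaryArrow (conjMap s t (𝟙 X)) := by
  constructor
  · rw [← conjMap_adj hunit hs ht, adj_id, conjMap_comp_conjMap, Category.comp_id, conjMap_id]
  · rw [← conjMap_adj hunit hs ht, adj_id, conjMap_comp_conjMap, Category.comp_id, conjMap_id]

/-- Every endomorphism of the conjugate is a conjugate `conjMap s s T`, and both its traces become
traces of `T*`; one of the two transfers uses `conjMap_adj`. -/
theorem IsSpherical.rev (hunit : HasIrreducibleUnit C) (hs : s.IsSpherical) :
    s.rev.IsSpherical := by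
  intro T
  obtain ⟨T, rfl⟩ := exists_conjMap_eq s s T
  have h₁ := Rbar_adj_conjMap (s := s) (t := s) (adj T)
  rw [conjMap_adj hunit hs hs, adj_adj] at h₁
  have h₂ := R_conjMap (s := s) (t := s) T
  change s.Rbar ≫ X ◁ conjMap s s T ≫ adj s.Rbar = s.R ≫ conjMap s s T ▷ X ≫ adj s.R
  rw [reassoc_of% h₁, reassoc_of% h₂]
  exact (hs (adj T)).symm

theorem IsSpherical.tensor (hs : s.IsSpherical) (ht : t.IsSpherical) :
    (s.tensor t).IsSpherical := by
  intro T
  -- `Φ` is the partial trace of `T` over `X` on the left, `Ψ` the one over `Y` on the right.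
  -- Sphericality of each factor reduces the claim to equality of the right trace of `Φ` and the
  -- left trace of `Ψ`.
  let Φ : Y ⟶ Y := (λ_ Y).inv ≫ s.R ▷ Y ≫ (α_ s.bar X Y).hom ≫ s.bar ◁ T ≫
    (α_ s.bar X Y).inv ≫ adj s.R ▷ Y ≫ (λ_ Y).hom
  let Ψ : X ⟶ X := (ρ_ X).inv ≫ X ◁ t.Rbar ≫ (α_ X Y t.bar).inv ≫ T ▷ t.bar ≫
    (α_ X Y t.bar).hom ≫ X ◁ adj t.Rbar ≫ (ρ_ X).hom
  have h₁ : (s.tensor t).trace T = t.trace Φ := by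
    change nest s.R t.R ≫ (t.bar ⊗ s.bar) ◁ T ≫ adj (nest s.R t.R) = t.R ≫ t.bar ◁ Φ ≫ adj t.R
    rw [adj_nest, nest]
    monoidal
  have h₂ : (s.tensor t).trace' T = s.trace' Ψ := by
    change nest t.Rbar s.Rbar ≫ T ▷ (t.bar ⊗ s.bar) ≫ adj (nest t.Rbar s.Rbar) =
      s.Rbar ≫ Ψ ▷ s.bar ≫ adj s.Rbar
    rw [adj_nest, nest]
    monoidal
  rw [h₁, h₂, ht, ← hs]
  -- Both numbers close `X` on the left and `Y` on the right; the two loops do not meet, so their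
  -- order is irrelevant.
  have e₁ : t.Rbar ≫ (λ_ (Y ⊗ t.bar)).inv ≫ s.R ▷ (Y ⊗ t.bar) =
      (ρ_ (𝟙_ C)).inv ≫ s.R ▷ 𝟙_ C ≫ (s.bar ⊗ X) ◁ t.Rbar := by
    rw [leftUnitor_inv_naturality_assoc, whisker_exchange, unitors_inv_equal]
  have e₂ := congrArg adj e₁
  simp only [adj_comp, adj_whiskerLeft, adj_whiskerRight, adj_leftUnitor_inv,
    adj_rightUnitor_inv, Category.assoc] at e₂
  calc
    t.trace' Φ = (t.Rbar ≫ (λ_ (Y ⊗ t.bar)).inv ≫ s.R ▷ (Y ⊗ t.bar)) ⊗≫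
        s.bar ◁ T ▷ t.bar ⊗≫ (adj s.R ▷ (Y ⊗ t.bar) ≫ (λ_ (Y ⊗ t.bar)).hom ≫ adj t.Rbar) := by
      rw [trace']; monoidal
    _ = s.trace Ψ := by
      rw [e₁, e₂, trace]; monoidal

theorem isSpherical_unit : (unit C).IsSpherical := by
  intro T
  change (λ_ (𝟙_ C)).inv ≫ 𝟙_ C ◁ T ≫ adj (λ_ (𝟙_ C)).inv =
    (λ_ (𝟙_ C)).inv ≫ T ▷ 𝟙_ C ≫ adj (λ_ (𝟙_ C)).inv
  rw [adj_leftUnitor_inv]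
  monoidal

end ConjugateSolution

/-! ### Standard solutions are spherical -/

section Projections

/-- Projections adding up to a projection are mutually orthogonal. -/
theorem IsStarProjection.mul_eq_zero_of_sum {A : Type*} [CStarAlgebra A] {ι : Type*} [Fintype ι]
    [DecidableEq ι] {p : ι → A} (hp : ∀ i, IsStarProjection (p i)) (hsum : ∑ i, p i = 1)
    {i j : ι} (hij : i ≠ j) : p i * p j = 0 := by
  let _ := CStarAlgebra.spectralOrder A
  have _ := CStarAlgebra.spectralOrderedRing A
  -- The term `k = j` already equals `p j`, so the other terms, which are the positive elements `(p
  -- k * p j)* (p k * p j)`, add up to zero.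
  have h1 : ∑ k, p j * p k * p j = p j := by
    rw [← Finset.sum_mul, ← Finset.mul_sum, hsum, mul_one, (hp j).isIdempotentElem]
  have h2 : ∑ k ∈ Finset.univ.erase j, p j * p k * p j = 0 := by
    rw [← Finset.add_sum_erase _ _ (Finset.mem_univ j)] at h1
    rwa [(hp j).isIdempotentElem.eq, (hp j).isIdempotentElem.eq, add_eq_left] at h1
  have h3 : ∀ k, p j * p k * p j = star (p k * p j) * (p k * p j) := fun k => by
    rw [star_mul, (hp k).isSelfAdjoint.star_eq, (hp j).isSelfAdjoint.star_eq, mul_assoc,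
      mul_assoc, ← mul_assoc (p k) (p k), (hp k).isIdempotentElem.eq]
  have h4 := (Finset.sum_eq_zero_iff_of_nonneg fun k _ => by
    rw [h3 k]; exact star_mul_self_nonneg _).mp h2 i
    (Finset.mem_erase.mpr ⟨hij, Finset.mem_univ i⟩)
  rw [h3, CStarRing.star_mul_self_eq_zero_iff] at h4
  exact h4

variable {C : Type u} [Category.{v} C] [MonoidalCategory C] [TensorCStarCategory C]

theorem isProjectionArrow_iff {X : C} {E : X ⟶ X} :
    IsProjectionArrow E ↔ IsStarProjection (show EndAlg C X from E) :=
  ⟨fun h => ⟨h.1, h.2⟩, fun h => ⟨h.1, h.2⟩⟩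

theorem IsProjectionArrow.comp_eq_zero {X : C} {n : ℕ} {E : Fin n → (X ⟶ X)}
    (hE : ∀ i, IsProjectionArrow (E i)) (hsum : ∑ i, E i = 𝟙 X) {i j : Fin n} (hij : i ≠ j) :
    E i ≫ E j = 0 :=
  IsStarProjection.mul_eq_zero_of_sum (A := EndAlg C X)
    (fun i => isProjectionArrow_iff.mp (hE i)) hsum hij

end Projections

namespace ConjugateSolution

variable {C : Type u} [Category.{v} C] [MonoidalCategory C] [TensorCStarCategory C] {X : C}

/-- Used for `x = R` and for `x = Rbar` with the same scalars `a i`, so that the two traces can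
differ only through the norms. -/
theorem comp_comp_adj_of_decomposition (hunit : HasIrreducibleUnit C) {W : C} {x : 𝟙_ C ⟶ W}
    {n : ℕ} {P : Fin n → (W ⟶ W)} (hP : ∀ i, IsProjectionArrow (P i)) (hx : ∑ i, x ≫ P i = x)
    {T : W ⟶ W} {a : Fin n → ℂ} (hT : ∀ i, P i ≫ T ≫ P i = a i • P i)
    (hT' : ∀ i j, i ≠ j → P i ≫ T ≫ P j = 0) :
    x ≫ T ≫ adj x = (∑ i, a i * ((‖x ≫ P i‖ ^ 2 : ℝ) : ℂ)) • 𝟙 (𝟙_ C) := by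
  have key : ∀ i j, (x ≫ P i) ≫ T ≫ adj (x ≫ P j) =
      if i = j then (a i * ((‖x ≫ P i‖ ^ 2 : ℝ) : ℂ)) • 𝟙 (𝟙_ C) else 0 := by
    intro i j
    have h : (x ≫ P i) ≫ T ≫ adj (x ≫ P j) = x ≫ (P i ≫ T ≫ P j) ≫ adj x := by
      simp only [adj_comp, (hP j).2, Category.assoc]
    rw [h]
    split_ifs with hij
    · subst hij
      rw [hT, mul_smul, ← hunit.comp_adj_eq, adj_comp, (hP i).2, Category.assoc,
        ← Category.assoc (P i) (P i), (hP i).1, CStarCategory.smul_comp, CStarCategory.comp_smul]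
    · rw [hT' i j hij, Limits.zero_comp, Limits.comp_zero]
  calc
    x ≫ T ≫ adj x = (∑ i, x ≫ P i) ≫ T ≫ adj (∑ j, x ≫ P j) := by rw [hx]
    _ = ∑ i, ∑ j, (x ≫ P i) ≫ T ≫ adj (x ≫ P j) := by
      rw [Preadditive.sum_comp]
      refine Finset.sum_congr rfl fun i _ => ?_
      rw [adj_sum, Preadditive.comp_sum, Preadditive.comp_sum]
    _ = _ := by
      simp only [key, Finset.sum_ite_eq, Finset.mem_univ, if_true, Finset.sum_smul]

theorem _root_.IsProjectionArrow.tensor {Y Z : C} {E : Y ⟶ Y} {F : Z ⟶ Z}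
    (hE : IsProjectionArrow E) (hF : IsProjectionArrow F) : IsProjectionArrow (E ⊗ₘ F) :=
  ⟨by rw [tensorHom_comp_tensorHom, hE.1, hF.1], by rw [adj_tensor, hE.2, hF.2]⟩

/-- Minimality gives the diagonal scalars. The terms with `i ≠ j` vanish by orthogonality of the `F
i`, although `E i T E j` may be nonzero. -/
theorem IsStandard.isSpherical (hunit : HasIrreducibleUnit C) {s : ConjugateSolution X}
    (hs : s.IsStandard) : s.IsSpherical := by
  obtain ⟨n, E, F, hE, hF, -, hF1, hR, hRbar, hnorm⟩ := hs
  intro T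
  choose a ha using fun i => (hE i).2.2 T
  have hF' : ∀ i j, i ≠ j → F i ≫ F j = 0 := fun i j => IsProjectionArrow.comp_eq_zero hF hF1
  have h₁ := comp_comp_adj_of_decomposition hunit (fun i => (hF i).tensor (hE i).1) hR
    (T := s.bar ◁ T) (a := a)
    (fun i => by
      rw [← id_tensorHom, tensorHom_comp_tensorHom, tensorHom_comp_tensorHom, ha, Category.id_comp,
        (hF i).1, tensor_smul])
    (fun i j hij => by
      rw [← id_tensorHom, tensorHom_comp_tensorHom, tensorHom_comp_tensorHom, Category.id_comp,
        hF' i j hij]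
      exact MonoidalPreadditive.zero_tensor _)
  have h₂ := comp_comp_adj_of_decomposition hunit (fun i => (hE i).1.tensor (hF i)) hRbar
    (T := T ▷ s.bar) (a := a)
    (fun i => by
      rw [← tensorHom_id, tensorHom_comp_tensorHom, tensorHom_comp_tensorHom, ha, Category.id_comp,
        (hF i).1, smul_tensor])
    (fun i j hij => by
      rw [← tensorHom_id, tensorHom_comp_tensorHom, tensorHom_comp_tensorHom, Category.id_comp,
        hF' i j hij]
      exact MonoidalPreadditive.tensor_zero _)
  rw [trace, trace', h₁, h₂]
  simp only [hnorm]

end ConjugateSolution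

/-! ### The functorial conjugation defined by standard solutions -/

namespace StandardChoice

open ConjugateSolution

variable {C : Type u} [Category.{v} C] [MonoidalCategory C] [TensorCStarCategory C]
  (hunit : HasIrreducibleUnit C) (S : StandardChoice C)

include hunit in
theorem isSpherical (X : C) : (S.sol X).IsSpherical :=
  (S.standard X).isSpherical hunit

/-- The formula defining `c` is the transposition formula for the product solution, whose `Rbar*` is
`eval`. -/
theorem c_eq (X Y : C) :
    S.c X Y = conjMap ((S.sol X).tensor (S.sol Y)) (S.sol (X ⊗ Y)) (𝟙 (X ⊗ Y)) := by
  rw [conjMap, adj_id, whiskerLeft_id, Category.comp_id]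
  change _ = (λ_ _).inv ≫ S.R (X ⊗ Y) ▷ _ ≫ (α_ _ _ _).hom ≫
    S.bar (X ⊗ Y) ◁ adj (nest (S.Rbar Y) (S.Rbar X)) ≫ (ρ_ _).hom
  rw [adj_nest]
  rfl

theorem d_eq (X : C) :
    S.d X = conjMap (S.sol X).rev (S.sol (S.bar X)) (𝟙 (S.bar X)) := by
  rw [conjMap, adj_id, whiskerLeft_id, Category.comp_id]
  rfl

theorem c_naturality {X Y X' Y' : C} (f : X ⟶ X') (g : Y ⟶ Y') :
    (conjMap (S.sol Y) (S.sol Y') g ⊗ₘ conjMap (S.sol X) (S.sol X') f) ≫ S.c X' Y' =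
      S.c X Y ≫ conjMap (S.sol (X ⊗ Y)) (S.sol (X' ⊗ Y')) (f ⊗ₘ g) := by
  rw [c_eq, c_eq, ← conjMap_tensor, conjMap_comp_conjMap, conjMap_comp_conjMap, Category.comp_id,
    Category.id_comp]

theorem d_naturality {X Y : C} (f : X ⟶ Y) :
    f ≫ S.d Y = S.d X ≫ conjMap (S.sol (S.bar X)) (S.sol (S.bar Y))
      (conjMap (S.sol X) (S.sol Y) f) := by
  rw [d_eq, d_eq, conjMap_comp_conjMap, Category.id_comp]
  conv_lhs => rw [← rev_conjMap (S.sol X) (S.sol Y) f]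
  exact (conjMap_comp_conjMap ..).trans (by rw [Category.comp_id])

theorem conjMap_d (X : C) :
    conjMap (S.sol X) (S.sol (S.bar (S.bar X))) (S.d X) = S.d (S.bar X) := by
  -- Since `d` is a conjugate of an identity, conjugating it back into the reversed solution gives
  -- an identity; the remaining factor is `d` of the conjugate.
  have h := rev_conjMap (S.sol X).rev (S.sol (S.bar X)) (𝟙 (S.bar X))
  rw [← d_eq] at h
  have h' := conjMap_comp_conjMap (S.sol X) (S.sol (S.bar X)).rev (S.sol (S.bar (S.bar X)))
    (S.d X) (𝟙 _)
  rw [Category.comp_id, ← d_eq] at h'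
  rw [← h', show conjMap (S.sol X) (S.sol (S.bar X)).rev (S.d X) = 𝟙 (S.bar X) from h]
  exact Category.id_comp _

/-- Each side compares a triple product solution with the chosen one; the two bracketings are
related by `conjMap_associator`. -/
theorem c_associativity (X Y Z : C) :
    S.c Y X ▷ S.bar Z ≫ S.c Z (Y ⊗ X) =
      (α_ (S.bar X) (S.bar Y) (S.bar Z)).hom ≫ S.bar X ◁ S.c Z Y ≫ S.c (Z ⊗ Y) X ≫
        conjMap (S.sol ((Z ⊗ Y) ⊗ X)) (S.sol (Z ⊗ Y ⊗ X)) (α_ Z Y X).hom := by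
  have h₁ : S.c Y X ▷ S.bar Z ≫ S.c Z (Y ⊗ X) =
      conjMap ((S.sol Z).tensor ((S.sol Y).tensor (S.sol X))) (S.sol (Z ⊗ Y ⊗ X)) (𝟙 _) := by
    have h := conjMap_tensor (s := S.sol Z) (s' := S.sol Z)
      (t := (S.sol Y).tensor (S.sol X)) (t' := S.sol (Y ⊗ X)) (𝟙 Z) (𝟙 (Y ⊗ X))
    rw [conjMap_id, id_tensorHom_id, ← c_eq] at h
    rw [← tensorHom_id, ← h, c_eq S Z, conjMap_comp_conjMap, Category.comp_id]
  have h₂ : S.bar X ◁ S.c Z Y ≫ S.c (Z ⊗ Y) X =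
      conjMap (((S.sol Z).tensor (S.sol Y)).tensor (S.sol X)) (S.sol ((Z ⊗ Y) ⊗ X)) (𝟙 _) := by
    have h := conjMap_tensor (s := (S.sol Z).tensor (S.sol Y)) (s' := S.sol (Z ⊗ Y))
      (t := S.sol X) (t' := S.sol X) (𝟙 (Z ⊗ Y)) (𝟙 X)
    rw [conjMap_id, id_tensorHom_id, ← c_eq] at h
    rw [← id_tensorHom, ← h, c_eq S (Z ⊗ Y), conjMap_comp_conjMap, Category.comp_id]
  rw [← Category.assoc (S.bar X ◁ S.c Z Y), h₂, conjMap_comp_conjMap, Category.id_comp, h₁,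
    ← Iso.inv_comp_eq, ← conjMap_associator]
  exact (conjMap_comp_conjMap ..).trans (by rw [Category.comp_id])

theorem c_d (X Y : C) :
    (S.d X ⊗ₘ S.d Y) ≫ S.c (S.bar Y) (S.bar X) ≫
      conjMap (S.sol (S.bar Y ⊗ S.bar X)) (S.sol (S.bar (X ⊗ Y))) (S.c X Y) = S.d (X ⊗ Y) := by
  have h₁ : S.d X ⊗ₘ S.d Y = conjMap ((S.sol X).tensor (S.sol Y)).rev
      ((S.sol (S.bar Y)).tensor (S.sol (S.bar X))) (𝟙 _) := by
    have h := conjMap_tensor (s := (S.sol Y).rev) (s' := S.sol (S.bar Y))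
      (t := (S.sol X).rev) (t' := S.sol (S.bar X)) (𝟙 (S.bar Y)) (𝟙 (S.bar X))
    rw [← d_eq, ← d_eq, id_tensorHom_id] at h
    exact h.symm
  -- Both sides of the goal turn into the conjugate of `c` from the reversed product to the chosen
  -- solution. Factoring it through `(S.sol (X ⊗ Y)).rev` leaves an identity followed by `d`.
  have h₂ := rev_conjMap ((S.sol X).tensor (S.sol Y)) (S.sol (X ⊗ Y)) (𝟙 (X ⊗ Y))
  rw [← c_eq] at h₂
  have h₃ := conjMap_comp_conjMap ((S.sol X).tensor (S.sol Y)).rev (S.sol (X ⊗ Y)).rev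
    (S.sol (S.bar (X ⊗ Y))) (S.c X Y) (𝟙 _)
  rw [h₂, Category.comp_id, ← d_eq] at h₃
  rw [h₁, c_eq S (S.bar Y), conjMap_comp_conjMap, Category.id_comp]
  refine (conjMap_comp_conjMap _ _ _ (𝟙 _) (S.c X Y)).trans ?_
  rw [Category.id_comp]
  exact h₃.symm.trans (Category.id_comp _)

/-- The functorial conjugation defined by a choice of standard solutions. -/
noncomputable def functorialConjugation : FunctorialConjugation S.bar where
  map {X Y} f := conjMap (S.sol X) (S.sol Y) f
  map_id X := conjMap_id _
  map_comp f g := (conjMap_comp_conjMap _ _ _ f g).symm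
  map_add := conjMap_add _ _
  map_smul := conjMap_smul _ _
  map_adj := conjMap_adj hunit (S.isSpherical hunit _) (S.isSpherical hunit _)
  d := S.d
  d_unitary X := by
    rw [d_eq]
    exact conjMap_one_unitary hunit ((S.isSpherical hunit X).rev hunit) (S.isSpherical hunit _)
  d_natural := S.d_naturality
  map_d := S.conjMap_d
  c := S.c
  c_unitary X Y := by
    rw [c_eq]
    exact conjMap_one_unitary hunit ((S.isSpherical hunit X).tensor (S.isSpherical hunit Y))
      (S.isSpherical hunit _)
  c_natural := S.c_naturality
  c_assoc := S.c_associativity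
  c_d := S.c_d

variable {S}

theorem _root_.FunctorialConjugation.IsDefinedBy.map_eq {K : FunctorialConjugation S.bar}
    (hK : K.IsDefinedBy S) {X Y : C} (f : X ⟶ Y) : K.map f = conjMap (S.sol X) (S.sol Y) f :=
  eq_conjMap (hK.1 X Y f)

theorem functorialConjugation_isDefinedBy : (S.functorialConjugation hunit).IsDefinedBy S :=
  ⟨fun _ _ T => R_conjMap T, fun _ _ => rfl, fun _ => rfl⟩

theorem _root_.FunctorialConjugation.IsDefinedBy.unique {K K' : FunctorialConjugation S.bar}
    (hK : K.IsDefinedBy S) (hK' : K'.IsDefinedBy S) : K = K' := by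
  have h₁ : @K.map = @K'.map := by
    funext X Y f
    rw [hK.map_eq, hK'.map_eq]
  have h₂ : K.c = K'.c := by
    funext X Y
    rw [hK.2.1, hK'.2.1]
  have h₃ : K.d = K'.d := by
    funext X
    rw [hK.2.2, hK'.2.2]
  cases K
  cases K'
  cases h₁
  cases h₂
  cases h₃
  rfl

end StandardChoice

/-! ### The conjugation given by a functorial conjugation -/

/-- A conjugate-linear unital `*`-homomorphism of C*-algebras is contractive. -/
theorem CStarAlgebra.norm_conj_hom_apply_le {A B : Type*} [CStarAlgebra A] [CStarAlgebra B]
    (φ : A →+* B) (hsmul : ∀ (z : ℂ) a, φ (z • a) = conj z • φ a) (hstar : ∀ a, φ (star a) = star (φ a))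
    (a : A) : ‖φ a‖ ≤ ‖a‖ := by
  have key : ∀ b : A, IsSelfAdjoint b → ‖φ b‖ ≤ ‖b‖ := by
    intro b hb
    have hb' : IsSelfAdjoint (φ b) := by rw [IsSelfAdjoint, ← hstar, hb.star_eq]
    have h : spectralRadius ℂ (φ b) ≤ spectralRadius ℂ b := by
      refine iSup₂_le fun z hz => ?_
      -- A conjugate-linear homomorphism sends `conj z - b` to `z - φ b`, so invertibility passes
      -- over and spectra are reflected.
      have hz' : conj z ∈ spectrum ℂ b := by
        by_contra hcon
        refine hz ?_
        rw [spectrum.notMem_iff] at hcon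
        have := hcon.map φ
        rwa [map_sub, Algebra.algebraMap_eq_smul_one, hsmul, map_one, Complex.conj_conj,
          ← Algebra.algebraMap_eq_smul_one] at this
      refine le_trans (le_of_eq ?_) (le_iSup₂ (f := fun (k : ℂ) (_ : k ∈ spectrum ℂ b) =>
        (‖k‖₊ : ENNReal)) (conj z) hz')
      rw [RCLike.nnnorm_conj]
    rw [hb'.spectralRadius_eq_nnnorm, hb.spectralRadius_eq_nnnorm] at h
    exact_mod_cast h
  have h := key (star a * a) (IsSelfAdjoint.star_mul_self a)
  rw [map_mul, hstar, CStarRing.norm_star_mul_self, CStarRing.norm_star_mul_self] at h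
  by_contra! hlt
  nlinarith [norm_nonneg a]

namespace FunctorialConjugation

variable {C : Type u} [Category.{v} C] [MonoidalCategory C] [TensorCStarCategory C]
  {bar : C → C} (K : FunctorialConjugation bar)

theorem map_zero {X Y : C} : K.map (0 : X ⟶ Y) = 0 := by
  simpa using K.map_smul 0 (0 : X ⟶ Y)

theorem norm_map_le {X Y : C} (f : X ⟶ Y) : ‖K.map f‖ ≤ ‖f‖ := by
  let φ : EndAlg C X →+* EndAlg C (bar X) :=
    { toFun := fun T => K.map (X := X) (Y := X) T
      map_one' := K.map_id X
      map_mul' := fun a b => K.map_comp (X := X) (Y := X) (Z := X) a b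
      map_zero' := K.map_zero
      map_add' := fun a b => K.map_add (X := X) (Y := X) a b }
  have h : ‖K.map (f ≫ adj f)‖ ≤ ‖f ≫ adj f‖ :=
    CStarAlgebra.norm_conj_hom_apply_le φ (fun z a => K.map_smul (X := X) (Y := X) z a)
      (fun a => K.map_adj (X := X) (Y := X) a) (f ≫ adj f)
  rw [K.map_comp, K.map_adj, norm_comp_adj, norm_comp_adj] at h
  exact le_of_sq_le_sq h (norm_nonneg f)

@[simp] theorem d_adj_d (X : C) : K.d X ≫ adj (K.d X) = 𝟙 X := (K.d_unitary X).1
@[simp] theorem adj_d_d (X : C) : adj (K.d X) ≫ K.d X = 𝟙 _ := (K.d_unitary X).2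
@[simp] theorem c_adj_c (X Y : C) : K.c X Y ≫ adj (K.c X Y) = 𝟙 _ := (K.c_unitary X Y).1
@[simp] theorem adj_c_c (X Y : C) : adj (K.c X Y) ≫ K.c X Y = 𝟙 _ := (K.c_unitary X Y).2

@[simp] theorem d_adj_d_assoc {X Z : C} (f : X ⟶ Z) : K.d X ≫ adj (K.d X) ≫ f = f := by
  rw [← Category.assoc, d_adj_d, Category.id_comp]
@[simp] theorem adj_d_d_assoc {X Z : C} (f : bar (bar X) ⟶ Z) : adj (K.d X) ≫ K.d X ≫ f = f := by
  rw [← Category.assoc, adj_d_d, Category.id_comp]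
@[simp] theorem c_adj_c_assoc {X Y Z : C} (f : _ ⟶ Z) : K.c X Y ≫ adj (K.c X Y) ≫ f = f := by
  rw [← Category.assoc, c_adj_c, Category.id_comp]
@[simp] theorem adj_c_c_assoc {X Y Z : C} (f : _ ⟶ Z) : adj (K.c X Y) ≫ K.c X Y ≫ f = f := by
  rw [← Category.assoc, adj_c_c, Category.id_comp]

theorem map_map {X Y : C} (f : X ⟶ Y) : K.map (K.map f) = adj (K.d X) ≫ f ≫ K.d Y := by
  rw [K.d_natural, adj_d_d_assoc]

/-- Up to the unitaries `d`, applying `map` twice gives back `f`, so a contraction must be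
isometric. -/
theorem norm_map {X Y : C} (f : X ⟶ Y) : ‖K.map f‖ = ‖f‖ := by
  refine le_antisymm (K.norm_map_le f) ?_
  have h : f = K.d X ≫ K.map (K.map f) ≫ adj (K.d Y) := by rw [map_map]; simp
  have h₁ := norm_le_one_of_comp_adj (K.d_unitary X).1
  have h₂ := norm_le_one_of_comp_adj (K.d_unitary Y).1
  rw [← norm_adj] at h₂
  calc
    ‖f‖ ≤ ‖K.d X‖ * ‖K.map (K.map f) ≫ adj (K.d Y)‖ := by
      conv_lhs => rw [h]
      exact norm_comp_le _ _
    _ ≤ 1 * (‖K.map (K.map f)‖ * 1) := by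
      gcongr
      exact (norm_comp_le _ _).trans (by gcongr)
    _ ≤ ‖K.map f‖ := by simpa using K.norm_map_le (K.map f)

theorem norm_d_comp {X Z : C} (f : bar (bar X) ⟶ Z) : ‖K.d X ≫ f‖ = ‖f‖ := by
  have h₁ := norm_le_one_of_comp_adj (K.d_unitary X).1
  apply le_antisymm
  · exact (norm_comp_le _ _).trans (mul_le_of_le_one_left (norm_nonneg _) h₁)
  · calc
      ‖f‖ = ‖adj (K.d X) ≫ K.d X ≫ f‖ := by rw [adj_d_d_assoc]
      _ ≤ ‖adj (K.d X)‖ * ‖K.d X ≫ f‖ := norm_comp_le _ _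
      _ ≤ _ := mul_le_of_le_one_left (norm_nonneg _) (by rwa [norm_adj])

theorem adj_c_natural {X Y X' Y' : C} (f : X ⟶ X') (g : Y ⟶ Y') :
    adj (K.c X Y) ≫ (K.map g ⊗ₘ K.map f) = K.map (f ⊗ₘ g) ≫ adj (K.c X' Y') := by
  have h := congrArg (fun x => adj (K.c X Y) ≫ x ≫ adj (K.c X' Y')) (K.c_natural f g)
  simpa using h

theorem map_map_adj_d {X Y : C} (f : X ⟶ Y) :
    K.map (K.map f) ≫ adj (K.d Y) = adj (K.d X) ≫ f := by
  rw [map_map]; simp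

/-- The semilinear C*-category whose antilinear arrows `X → Y` are the arrows `bar X → Y`:
the arrow `T` stands for `T ∘ J_X`. -/
abbrev semilinear : SemilinearCStar C where
  AHom X Y := bar X ⟶ Y
  normed _ _ := inferInstance
  space _ _ := inferInstance
  complete _ _ := inferInstance
  -- The formulas are forced by `J_Y ∘ f = map f ∘ J_X`, `J_{bar X} ∘ J_X = d_X` and the consequence
  -- `J_X* = d_X* ∘ J_{bar X}`.
  la f r := K.map f ≫ r
  al r g := r ≫ g
  aa r s := K.d _ ≫ K.map r ≫ s
  star {X _} r := K.map (adj r) ≫ adj (K.d X)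
  la_add_left f g r := by rw [K.map_add, CStarCategory.add_comp]
  la_add_right f r s := CStarCategory.comp_add _ _ _
  al_add_left r s f := CStarCategory.add_comp _ _ _
  al_add_right r f g := CStarCategory.comp_add _ _ _
  aa_add_left r s t := by rw [K.map_add, CStarCategory.add_comp, CStarCategory.comp_add]
  aa_add_right r s t := by rw [CStarCategory.comp_add, CStarCategory.comp_add]
  la_smul a b f r := by
    rw [K.map_smul, CStarCategory.smul_comp, CStarCategory.comp_smul, smul_smul, mul_comm]
  al_smul a b r f := by
    rw [CStarCategory.smul_comp, CStarCategory.comp_smul, smul_smul, mul_comm]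
  aa_smul a b r s := by
    rw [K.map_smul, CStarCategory.smul_comp, CStarCategory.comp_smul, CStarCategory.comp_smul,
      CStarCategory.comp_smul, smul_smul, mul_comm]
  id_la r := by rw [K.map_id, Category.id_comp]
  al_id r := Category.comp_id _
  assoc_lla f g r := by rw [K.map_comp, Category.assoc]
  assoc_lal f r g := Category.assoc _ _ _
  assoc_all r f g := Category.assoc _ _ _
  assoc_laa f r s := by
    rw [K.map_comp, Category.assoc, ← Category.assoc (K.d _), ← K.d_natural, Category.assoc]
  assoc_ala r f s := by rw [K.map_comp, Category.assoc]
  assoc_aal r s f := by simp only [Category.assoc]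
  assoc_aaa r s t := by
    rw [K.map_comp, K.map_comp, K.map_d, Category.assoc, Category.assoc,
      ← Category.assoc (K.d _) (K.map (K.map r)), ← K.d_natural, Category.assoc]
  star_star {X Y} r := by
    rw [adj_comp, adj_adj, ← K.map_adj, adj_adj, K.map_comp, K.map_d, Category.assoc,
      K.map_map_adj_d, d_adj_d_assoc]
  star_add r s := by rw [adj_add, K.map_add, CStarCategory.add_comp]
  star_smul a r := by
    rw [adj_smul, K.map_smul, Complex.conj_conj, CStarCategory.smul_comp]
  star_la f r := by
    rw [adj_comp, K.map_comp, ← K.map_adj, Category.assoc, Category.assoc, K.map_map_adj_d]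
  star_al r f := by rw [adj_comp, K.map_comp, Category.assoc]
  adj_aa r s := by
    rw [K.map_comp, adj_comp, adj_comp, ← K.map_adj, K.map_adj (K.d _), K.map_d, map_map]
    simp
  norm_la_le f r := (norm_comp_le _ _).trans (by gcongr; exact K.norm_map_le f)
  norm_al_le r f := norm_comp_le _ _
  norm_aa_le r s := by
    rw [norm_d_comp]
    exact (norm_comp_le _ _).trans (by gcongr; exact K.norm_map_le r)
  norm_aa_star {X Y} r := by
    have h : K.d X ≫ K.map r ≫ K.map (adj r) ≫ adj (K.d X) =
        (K.d X ≫ K.map r) ≫ adj (K.d X ≫ K.map r) := by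
      rw [adj_comp, K.map_adj, Category.assoc]
    rw [h, norm_comp_adj, norm_d_comp, norm_map]
  aa_star_positive {X Y} r := by
    have h : K.d X ≫ K.map r ≫ K.map (adj r) ≫ adj (K.d X) =
        (K.d X ≫ K.map r) ≫ adj (K.d X ≫ K.map r) := by
      rw [adj_comp, K.map_adj, Category.assoc]
    rw [h]
    exact comp_adj_positive _

/-- The semilinear tensor C*-category given by a functorial conjugation. The arrow `e` compares
the conjugate of the tensor unit with the tensor unit. -/
def semilinearTensor (e : bar (𝟙_ C) ⟶ 𝟙_ C) (he : IsUnitaryArrow e)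
    (hl : ∀ X : C, bar X ◁ e ≫ (ρ_ (bar X)).hom = K.c (𝟙_ C) X ≫ K.map (λ_ X).hom)
    (hr : ∀ X : C, e ▷ bar X ≫ (λ_ (bar X)).hom = K.c X (𝟙_ C) ≫ K.map (ρ_ X).hom) :
    SemilinearTensorCStar C where
  toSemilinearCStar := K.semilinear
  -- Forced by `J_X × J_{X'} = c* ∘ J_{XX'}`, where the tensor product of antilinear arrows reverses
  -- the factors of the target.
  tensor {X _ X' _} r s := adj (K.c X X') ≫ (s ⊗ₘ r)
  add_tensor r s t := (congrArg _ (TensorCStarCategory.tensor_add t r s)).trans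
    (CStarCategory.comp_add _ _ _)
  tensor_add r s t := (congrArg _ (TensorCStarCategory.add_tensor s t r)).trans
    (CStarCategory.comp_add _ _ _)
  smul_tensor a r s := (congrArg _ (TensorCStarCategory.tensor_smul a s r)).trans
    (CStarCategory.comp_smul _ _ _)
  tensor_smul a r s := (congrArg _ (TensorCStarCategory.smul_tensor a s r)).trans
    (CStarCategory.comp_smul _ _ _)
  tensor_al r r' g g' := by
    change (adj (K.c _ _) ≫ (r' ⊗ₘ r)) ≫ (g' ⊗ₘ g) = adj (K.c _ _) ≫ ((r' ≫ g') ⊗ₘ (r ≫ g))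
    rw [Category.assoc, tensorHom_comp_tensorHom]
  tensor_la f f' r r' := by
    change K.map (f ⊗ₘ f') ≫ adj (K.c _ _) ≫ (r' ⊗ₘ r) =
      adj (K.c _ _) ≫ ((K.map f' ≫ r') ⊗ₘ (K.map f ≫ r))
    rw [← Category.assoc, ← adj_c_natural, Category.assoc, tensorHom_comp_tensorHom]
  tensor_aa {X Y Z X' Y' Z'} r r' s s' := by
    change K.d _ ≫ K.map (adj (K.c _ _) ≫ (r' ⊗ₘ r)) ≫ adj (K.c _ _) ≫ (s ⊗ₘ s') =
      (K.d _ ≫ K.map r ≫ s) ⊗ₘ (K.d _ ≫ K.map r' ≫ s')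
    rw [← K.c_d, K.map_comp, K.map_adj]
    have h : K.map (K.c X X') ≫ adj (K.map (K.c X X')) = 𝟙 _ := by
      rw [← K.map_adj, ← K.map_comp, c_adj_c, K.map_id]
    simp only [Category.assoc, reassoc_of% h]
    have h' := K.c_natural r' r
    rw [← reassoc_of% h', c_adj_c_assoc, tensorHom_comp_tensorHom, tensorHom_comp_tensorHom]
  star_tensor {X Y X' Y'} r s := by
    change K.map (adj (adj (K.c X X') ≫ (s ⊗ₘ r))) ≫ adj (K.d _) =
      adj (K.c Y' Y) ≫ ((K.map (adj r) ≫ adj (K.d X)) ⊗ₘ (K.map (adj s) ≫ adj (K.d X')))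
    have h : K.map (K.c X X') ≫ adj (K.map (K.c X X')) = 𝟙 _ := by
      rw [← K.map_adj, ← K.map_comp, c_adj_c, K.map_id]
    rw [← tensorHom_comp_tensorHom, ← Category.assoc, adj_c_natural, ← K.c_d, adj_comp, adj_comp,
      adj_comp, adj_adj, K.map_comp, adj_tensor, adj_tensor]
    simp only [Category.assoc, reassoc_of% h]
  tensor_assoc {X Y X' Y' X'' Y''} r s t := by
    change (adj (K.c (X ⊗ X') X'') ≫ (t ⊗ₘ (adj (K.c X X') ≫ (s ⊗ₘ r)))) ≫ (α_ Y'' Y' Y).inv =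
      K.map (α_ X X' X'').hom ≫ adj (K.c X (X' ⊗ X'')) ≫ ((adj (K.c X' X'') ≫ (t ⊗ₘ s)) ⊗ₘ r)
    have h := congrArg adj (K.c_assoc X'' X' X)
    simp only [adj_comp, adj_whiskerLeft, adj_whiskerRight, adj_associator, ← K.map_adj,
      Category.assoc] at h
    have h₁ : (adj (K.c X' X'') ≫ (t ⊗ₘ s)) ⊗ₘ r =
        adj (K.c X' X'') ▷ bar X ≫ ((t ⊗ₘ s) ⊗ₘ r) := by
      rw [← tensorHom_id, tensorHom_comp_tensorHom, Category.id_comp]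
    have h₂ : t ⊗ₘ (adj (K.c X X') ≫ (s ⊗ₘ r)) =
        bar X'' ◁ adj (K.c X X') ≫ (t ⊗ₘ (s ⊗ₘ r)) := by
      rw [← id_tensorHom, tensorHom_comp_tensorHom, Category.id_comp]
    have h₃ : K.map (α_ X X' X'').hom ≫ K.map (α_ X X' X'').inv = 𝟙 _ := by
      rw [← K.map_comp, Iso.hom_inv_id, K.map_id]
    rw [h₁, h₂, reassoc_of% h, reassoc_of% h₃, Category.assoc, Category.assoc,
      associator_inv_naturality]
  exists_unit := by
    refine ⟨e, ⟨?_, ?_⟩, fun {X Y} r => ⟨?_, ?_⟩⟩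
    · change K.d _ ≫ K.map e ≫ K.map (adj e) ≫ adj (K.d _) = _
      rw [← Category.assoc (K.map e), ← K.map_comp, he.1, K.map_id, Category.id_comp, d_adj_d]
    · change K.d _ ≫ K.map (K.map (adj e) ≫ adj (K.d _)) ≫ e = _
      rw [K.map_comp, K.map_adj (K.d _), K.map_d, map_map]
      simp [he.2]
    · change (adj (K.c (𝟙_ C) X) ≫ (r ⊗ₘ e)) ≫ (ρ_ Y).hom = K.map (λ_ X).hom ≫ r
      rw [tensorHom_def', Category.assoc, Category.assoc, rightUnitor_naturality,
        reassoc_of% hl X, adj_c_c_assoc]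
    · change (adj (K.c X (𝟙_ C)) ≫ (e ⊗ₘ r)) ≫ (λ_ Y).hom = K.map (ρ_ X).hom ≫ r
      rw [MonoidalCategory.tensorHom_def, Category.assoc, Category.assoc, leftUnitor_naturality,
        reassoc_of% hr X, adj_c_c_assoc]

theorem exists_conjugation (e : bar (𝟙_ C) ⟶ 𝟙_ C) (he : IsUnitaryArrow e)
    (hl : ∀ X : C, bar X ◁ e ≫ (ρ_ (bar X)).hom = K.c (𝟙_ C) X ≫ K.map (λ_ X).hom)
    (hr : ∀ X : C, e ▷ bar X ≫ (λ_ (bar X)).hom = K.c X (𝟙_ C) ≫ K.map (ρ_ X).hom) :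
    ∃ (A : Conjugation C) (J : ∀ X : C, A.AHom X (bar X)), A.IsAssociatedWith K J := by
  -- As `T` stands for `T ∘ J_X`, the arrow `J_X` itself is represented by the identity of `bar X`.
  have hJ : ∀ X : C, K.semilinear.IsAntiunitary (X := X) (Y := bar X) (𝟙 (bar X)) := by
    intro X
    constructor
    · change K.d _ ≫ K.map (𝟙 _) ≫ K.map (adj (𝟙 _)) ≫ adj (K.d _) = _
      simp [adj_id, K.map_id]
    · change K.d _ ≫ K.map (K.map (adj (𝟙 _)) ≫ adj (K.d _)) ≫ 𝟙 _ = _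
      rw [adj_id, K.map_id, Category.id_comp, K.map_adj, K.map_d, Category.comp_id, d_adj_d]
  refine ⟨⟨K.semilinearTensor e he hl hr, fun X => ⟨_, _, hJ X⟩⟩, fun X => 𝟙 (bar X), hJ, ?_, ?_, ?_⟩
  · intro X Y T
    change _ = K.d _ ≫ K.map (K.map (adj (𝟙 _)) ≫ adj (K.d _)) ≫ K.map T ≫ 𝟙 _
    rw [adj_id, K.map_id, Category.id_comp, K.map_adj, K.map_d, Category.comp_id, d_adj_d_assoc]
  · intro X
    change _ = K.d X ≫ K.map (𝟙 _) ≫ 𝟙 _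
    rw [K.map_id, Category.id_comp, Category.comp_id]
  · intro X Y
    change _ = K.d _ ≫ K.map (K.map (adj (adj (K.c X Y) ≫ (𝟙 _ ⊗ₘ 𝟙 _))) ≫ adj (K.d _)) ≫ 𝟙 _
    rw [id_tensorHom_id, Category.comp_id, Category.comp_id, adj_adj, K.map_comp, K.map_adj,
      K.map_d, map_map]
    simp

end FunctorialConjugation

namespace StandardChoice

open ConjugateSolution

variable {C : Type u} [Category.{v} C] [MonoidalCategory C] [TensorCStarCategory C]
  (hunit : HasIrreducibleUnit C) (S : StandardChoice C)

theorem exists_conjugation :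
    ∃ (A : Conjugation C) (J : ∀ X : C, A.AHom X (S.bar X)),
      A.IsAssociatedWith (S.functorialConjugation hunit) J := by
  refine (S.functorialConjugation hunit).exists_conjugation
    -- The antiunitary unit compares the chosen solution for `ι` with the trivial one; its unit laws
    -- are the conjugates of the unitors.
    (conjMap (S.sol (𝟙_ C)) (unit C) (𝟙 (𝟙_ C)))
    (conjMap_one_unitary hunit (S.isSpherical hunit _) isSpherical_unit) (fun X => ?_) (fun X => ?_)
  · change _ = S.c _ _ ≫ conjMap _ _ _
    have h := conjMap_tensor (s := S.sol (𝟙_ C)) (s' := unit C)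
      (t := S.sol X) (t' := S.sol X) (𝟙 (𝟙_ C)) (𝟙 X)
    rw [conjMap_id, id_tensorHom_id] at h
    rw [c_eq, conjMap_comp_conjMap, Category.id_comp, ← id_tensorHom, ← h, ← conjMap_leftUnitor,
      conjMap_comp_conjMap, Category.id_comp]
  · change _ = S.c _ _ ≫ conjMap _ _ _
    have h := conjMap_tensor (s := S.sol X) (s' := S.sol X)
      (t := S.sol (𝟙_ C)) (t' := unit C) (𝟙 X) (𝟙 (𝟙_ C))
    rw [conjMap_id, id_tensorHom_id] at h
    rw [c_eq, conjMap_comp_conjMap, Category.id_comp, ← tensorHom_id, ← h, ← conjMap_rightUnitor,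
      conjMap_comp_conjMap, Category.id_comp]

end StandardChoice

/-! ### Uniqueness of the associated conjugation -/

namespace SemilinearCStar

variable {C : Type u} [Category.{v} C] [CStarCategory C] (A : SemilinearCStar C)

variable {A} in
theorem IsAntiunitary.al_aa_star {X Y Z : C} {J : A.AHom X Y} (hJ : A.IsAntiunitary J)
    (r : A.AHom X Z) : A.al J (A.aa (A.star J) r) = r := by
  rw [← A.assoc_aaa, hJ.1, A.id_la]

variable {A} in
theorem IsAntiunitary.aa_star_al {X Y Z : C} {J : A.AHom X Y} (hJ : A.IsAntiunitary J)
    (f : Y ⟶ Z) : A.aa (A.star J) (A.al J f) = f := by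
  rw [← A.assoc_aal, hJ.2, Category.id_comp]

variable {A} in
theorem IsAntiunitary.star {X Y : C} {J : A.AHom X Y} (hJ : A.IsAntiunitary J) :
    A.IsAntiunitary (A.star J) := by
  refine ⟨?_, ?_⟩
  · rw [A.star_star]; exact hJ.2
  · rw [A.star_star]; exact hJ.1

variable {A} in
theorem IsAntiunitary.norm_le_one {X Y : C} {J : A.AHom X Y} (hJ : A.IsAntiunitary J) :
    ‖J‖ ≤ 1 := by
  have h := A.norm_aa_star J
  rw [hJ.1] at h
  nlinarith [norm_id_le X, norm_nonneg J]

variable {A} in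
theorem IsAntiunitary.norm_al {X Y Z : C} {J : A.AHom X Y} (hJ : A.IsAntiunitary J)
    (f : Y ⟶ Z) : ‖A.al J f‖ = ‖f‖ := by
  apply le_antisymm
  · exact (A.norm_al_le J f).trans (mul_le_of_le_one_left (norm_nonneg f) hJ.norm_le_one)
  · calc
      ‖f‖ = ‖A.aa (A.star J) (A.al J f)‖ := by rw [hJ.aa_star_al]
      _ ≤ ‖A.star J‖ * ‖A.al J f‖ := A.norm_aa_le _ _
      _ ≤ _ := mul_le_of_le_one_left (norm_nonneg _) hJ.star.norm_le_one

theorem al_smul_right {X Y Z : C} (a : ℂ) (r : A.AHom X Y) (f : Y ⟶ Z) :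
    A.al r (a • f) = a • A.al r f := by
  simpa using A.al_smul 1 a r f

variable {A} in
/-- Composition with an antiunitary, as an isometric isomorphism. -/
noncomputable def IsAntiunitary.equiv {X Y : C} {J : A.AHom X Y} (hJ : A.IsAntiunitary J) (Z : C) :
    (Y ⟶ Z) ≃ₗᵢ[ℂ] A.AHom X Z where
  toFun f := A.al J f
  invFun r := A.aa (A.star J) r
  map_add' f g := A.al_add_right J f g
  map_smul' a f := A.al_smul_right a J f
  left_inv f := hJ.aa_star_al f
  right_inv r := hJ.al_aa_star r
  norm_map' f := hJ.norm_al f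

end SemilinearCStar

namespace Conjugation

variable {C : Type u} [Category.{v} C] [MonoidalCategory C] [TensorCStarCategory C]

namespace IsAssociatedWith

variable {A : Conjugation C} {bar : C → C} {K : FunctorialConjugation bar}
  {J : ∀ X : C, A.AHom X (bar X)} (h : A.IsAssociatedWith K J)

include h

/-- This commutation rule and the next lemmas express every operation on arrows `f ∘ J_X` through
`K`, so that `K` determines the conjugation. -/
theorem la_J {X Y : C} (f : X ⟶ Y) : A.la f (J Y) = A.al (J X) (K.map f) := by
  rw [h.map_eq, (h.antiunitary X).al_aa_star]

theorem la_al {X Y Z : C} (f : X ⟶ Y) (g : bar Y ⟶ Z) :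
    A.la f (A.al (J Y) g) = A.al (J X) (K.map f ≫ g) := by
  rw [← A.assoc_lal, h.la_J, A.assoc_all]

theorem aa_al {X Y Z : C} (f : bar X ⟶ Y) (g : bar Y ⟶ Z) :
    A.aa (A.al (J X) f) (A.al (J Y) g) = K.d X ≫ K.map f ≫ g := by
  rw [A.assoc_ala, h.la_al, ← A.assoc_aal, ← h.d_eq]

theorem star_J (X : C) : A.star (J X) = A.al (J (bar X)) (adj (K.d X)) := by
  rw [h.d_eq, A.adj_aa, (h.antiunitary _).al_aa_star]

theorem star_al {X Y : C} (f : bar X ⟶ Y) :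
    A.star (A.al (J X) f) = A.al (J Y) (K.map (adj f) ≫ adj (K.d X)) := by
  rw [A.star_al, h.star_J, h.la_al]

theorem tensor_J (X Y : C) : A.tensor (J X) (J Y) = A.al (J (X ⊗ Y)) (adj (K.c X Y)) := by
  rw [h.c_eq, A.adj_aa, A.star_star, (h.antiunitary _).al_aa_star]

theorem tensor_al {X Y X' Y' : C} (f : bar X ⟶ Y) (g : bar X' ⟶ Y') :
    A.tensor (A.al (J X) f) (A.al (J X') g) =
      A.al (J (X ⊗ X')) (adj (K.c X X') ≫ (g ⊗ₘ f)) := by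
  rw [← A.tensor_al, h.tensor_J, A.assoc_all]

/-- Two conjugations associated with the same functorial conjugation are isomorphic. -/
noncomputable def iso {A' : Conjugation C} {J' : ∀ X : C, A'.AHom X (bar X)}
    (h' : A'.IsAssociatedWith K J') : Conjugation.Iso A' A where
  toEquiv X Y := ((h'.antiunitary X).equiv Y).symm.trans ((h.antiunitary X).equiv Y)
  map_la {X Y Z} f r := by
    obtain ⟨g, rfl⟩ := ((h'.antiunitary Y).equiv Z).surjective r
    have e : A'.la f ((h'.antiunitary Y).equiv Z g) = (h'.antiunitary X).equiv Z (K.map f ≫ g) :=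
      h'.la_al f g
    simp only [LinearIsometryEquiv.trans_apply, e, LinearIsometryEquiv.symm_apply_apply]
    exact (h.la_al f g).symm
  map_al {X Y Z} r f := by
    obtain ⟨g, rfl⟩ := ((h'.antiunitary X).equiv Y).surjective r
    have e : A'.al ((h'.antiunitary X).equiv Y g) f = (h'.antiunitary X).equiv Z (g ≫ f) :=
      A'.assoc_all _ _ _
    simp only [LinearIsometryEquiv.trans_apply, e, LinearIsometryEquiv.symm_apply_apply]
    exact (A.assoc_all _ _ _).symm
  map_aa {X Y Z} r s := by
    obtain ⟨f, rfl⟩ := ((h'.antiunitary X).equiv Y).surjective r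
    obtain ⟨g, rfl⟩ := ((h'.antiunitary Y).equiv Z).surjective s
    simp only [LinearIsometryEquiv.trans_apply, LinearIsometryEquiv.symm_apply_apply]
    exact (h.aa_al f g).trans (h'.aa_al f g).symm
  map_star {X Y} r := by
    obtain ⟨f, rfl⟩ := ((h'.antiunitary X).equiv Y).surjective r
    have e : A'.star ((h'.antiunitary X).equiv Y f) =
        (h'.antiunitary Y).equiv X (K.map (adj f) ≫ adj (K.d X)) := h'.star_al f
    simp only [LinearIsometryEquiv.trans_apply, e, LinearIsometryEquiv.symm_apply_apply]
    exact (h.star_al f).symm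
  map_tensor {X Y X' Y'} r s := by
    obtain ⟨f, rfl⟩ := ((h'.antiunitary X).equiv Y).surjective r
    obtain ⟨g, rfl⟩ := ((h'.antiunitary X').equiv Y').surjective s
    have e : A'.tensor ((h'.antiunitary X).equiv Y f) ((h'.antiunitary X').equiv Y' g) =
        (h'.antiunitary (X ⊗ X')).equiv (Y' ⊗ Y) (adj (K.c X X') ≫ (g ⊗ₘ f)) := h'.tensor_al f g
    simp only [LinearIsometryEquiv.trans_apply, e, LinearIsometryEquiv.symm_apply_apply]
    exact (h.tensor_al f g).symm

theorem iso_J {A' : Conjugation C} {J' : ∀ X : C, A'.AHom X (bar X)}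
    (h' : A'.IsAssociatedWith K J') (X : C) : (h.iso h').toEquiv X (bar X) (J' X) = J X := by
  have e : ((h'.antiunitary X).equiv (bar X)).symm (J' X) = 𝟙 _ := (h'.antiunitary X).2
  change (h.antiunitary X).equiv (bar X) (((h'.antiunitary X).equiv (bar X)).symm (J' X)) = _
  rw [e]
  exact A.al_id _

theorem existsUnique_iso {A' : Conjugation C} {J' : ∀ X : C, A'.AHom X (bar X)}
    (h' : A'.IsAssociatedWith K J') :
    ∃! Φ : Conjugation.Iso A' A, ∀ X, Φ.toEquiv X (bar X) (J' X) = J X := by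
  refine ⟨h.iso h', h.iso_J h', fun Φ hΦ => ?_⟩
  have key : Φ.toEquiv = (h.iso h').toEquiv := by
    funext X Y
    ext r
    -- Every antilinear arrow is a linear one composed with `J'`, so an isomorphism fixing linear
    -- arrows is determined by its values on `J'`.
    rw [← (h'.antiunitary X).al_aa_star r, Φ.map_al, (h.iso h').map_al, hΦ, h.iso_J h']
  cases Φ
  congr

/-- Changing the conjugates by unitaries. -/
theorem of_unitary {bar' : C → C} {K' : FunctorialConjugation bar'} (U : ∀ X : C, bar X ⟶ bar' X)
    (hU : ∀ X, IsUnitaryArrow (U X))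
    (hmap : ∀ {X Y : C} (f : X ⟶ Y), K'.map f = adj (U X) ≫ K.map f ≫ U Y)
    (hd : ∀ X, K'.d X = K.d X ≫ K.map (U X) ≫ U (bar' X))
    (hc : ∀ X Y, K'.c X Y = (adj (U Y) ⊗ₘ adj (U X)) ≫ K.c X Y ≫ U (X ⊗ Y)) :
    A.IsAssociatedWith K' fun X => A.al (J X) (U X) where
  antiunitary X := by
    constructor
    · rw [A.star_al, ← A.assoc_ala, A.assoc_all, (hU X).1, A.al_id, (h.antiunitary X).1]
    · rw [A.star_al, A.assoc_laa, (h.antiunitary X).aa_star_al, (hU X).2]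
  map_eq {X Y} f := by
    rw [hmap, h.la_al, A.star_al, A.assoc_laa, (h.antiunitary X).aa_star_al]
  d_eq X := by rw [hd, h.aa_al]
  c_eq X Y := by
    rw [hc, ← A.tensor_al, A.star_al, A.assoc_laa, adj_tensor, ← A.assoc_aal, ← h.c_eq]

end IsAssociatedWith

end Conjugation

namespace StandardChoice

open ConjugateSolution

variable {C : Type u} [Category.{v} C] [MonoidalCategory C] [TensorCStarCategory C]
  (hunit : HasIrreducibleUnit C) (S S' : StandardChoice C)

/-- The unitaries comparing two choices of standard solutions. -/
def comparison (X : C) : S.bar X ⟶ S'.bar X :=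
  conjMap (S.sol X) (S'.sol X) (𝟙 X)

include hunit in
theorem comparison_unitary (X : C) : IsUnitaryArrow (S.comparison S' X) :=
  conjMap_one_unitary hunit (S.isSpherical hunit X) (S'.isSpherical hunit X)

theorem R_comparison (X : C) : S'.R X = S.R X ≫ S.comparison S' X ▷ X := by
  rw [comparison, R_conjMap, adj_id, whiskerLeft_id, Category.comp_id]

include hunit in
theorem adj_comparison (X : C) :
    adj (S.comparison S' X) = conjMap (S'.sol X) (S.sol X) (𝟙 X) := by
  rw [comparison, ← conjMap_adj hunit (S.isSpherical hunit X) (S'.isSpherical hunit X), adj_id]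

include hunit in
theorem map_comparison {X Y : C} (f : X ⟶ Y) :
    conjMap (S'.sol X) (S'.sol Y) f =
      adj (S.comparison S' X) ≫ conjMap (S.sol X) (S.sol Y) f ≫ S.comparison S' Y := by
  rw [adj_comparison hunit, comparison, conjMap_comp_conjMap, conjMap_comp_conjMap,
    Category.id_comp, Category.comp_id]

theorem d_comparison (X : C) :
    S'.d X = S.d X ≫ conjMap (S.sol (S.bar X)) (S.sol (S'.bar X)) (S.comparison S' X) ≫
      S.comparison S' (S'.bar X) := by
  have h := rev_conjMap (S.sol X) (S'.sol X) (𝟙 X)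
  have h' := conjMap_comp_conjMap (S.sol X).rev (S'.sol X).rev (S'.sol (S'.bar X))
    (S.comparison S' X) (𝟙 _)
  rw [comparison, h, Category.comp_id, ← d_eq] at h'
  rw [d_eq S, comparison, comparison, conjMap_comp_conjMap, conjMap_comp_conjMap,
    Category.id_comp, Category.comp_id, ← h']
  exact (Category.id_comp _).symm

include hunit in
theorem c_comparison (X Y : C) :
    S'.c X Y = (adj (S.comparison S' Y) ⊗ₘ adj (S.comparison S' X)) ≫ S.c X Y ≫
      S.comparison S' (X ⊗ Y) := by
  rw [adj_comparison hunit, adj_comparison hunit, ← conjMap_tensor, c_eq, c_eq, comparison,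
    conjMap_comp_conjMap, conjMap_comp_conjMap, id_tensorHom_id, Category.id_comp, Category.id_comp]

-- One and the same conjugation serves both choices, with `U ∘ J` in place of `J`. Independence of
-- the choice thus reduces to uniqueness for a single functorial conjugation.
include hunit in
theorem isAssociatedWith_comparison {S S' : StandardChoice C} {K : FunctorialConjugation S.bar}
    {K' : FunctorialConjugation S'.bar} {A : Conjugation C} {J : ∀ X : C, A.AHom X (S.bar X)}
    (hK : K.IsDefinedBy S) (hK' : K'.IsDefinedBy S') (h : A.IsAssociatedWith K J) :
    A.IsAssociatedWith K' fun X => A.al (J X) (S.comparison S' X) := by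
  refine h.of_unitary _ (S.comparison_unitary hunit S') (fun f => ?_) (fun X => ?_) (fun X Y => ?_)
  · rw [hK.map_eq, hK'.map_eq, S.map_comparison hunit S']
  · rw [hK'.2.2, hK.2.2, hK.map_eq, S.d_comparison S']
  · rw [hK'.2.1, hK.2.1, S.c_comparison hunit S']

end StandardChoice

/-! ### Projections in finite-dimensional C*-algebras -/

namespace CStarAlgebra

variable {A : Type*} [CStarAlgebra A]

theorem finite_spectrum_real [FiniteDimensional ℂ A] (b : A) : (spectrum ℝ b).Finite := by
  nontriviality A
  have : FiniteDimensional ℝ A := FiniteDimensional.complexToReal A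
  have hb : IsIntegral ℝ b := Algebra.IsIntegral.isIntegral b
  refine ((minpoly ℝ b).roots.toFinset.finite_toSet).subset fun x hx => ?_
  have h := spectrum.subset_polynomial_aeval b (minpoly ℝ b) ⟨x, hx, rfl⟩
  rw [minpoly.aeval, spectrum.zero_eq, Set.mem_singleton_iff] at h
  simp only [Finset.mem_coe, Multiset.mem_toFinset]
  exact (Polynomial.mem_roots (minpoly.ne_zero hb)).mpr h

/-- If a projection has no nontrivial subprojection, then its corner is trivial: the case of
self-adjoint elements. -/
theorem exists_eq_smul_of_isSelfAdjoint [FiniteDimensional ℂ A] {p : A} (hp : IsStarProjection p)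
    (hmin : ∀ q : A, IsStarProjection q → q * p = q → q = 0 ∨ q = p) {b : A}
    (hb : IsSelfAdjoint b) (hpb : p * b = b) (hbp : b * p = b) : ∃ z : ℝ, b = z • p := by
  classical
  -- The spectral projections of `b`. The spectrum is finite, so every function on it is continuous.
  -- They commute with `p`, so minimality makes each `e x * p` equal to `0` or `p`; if it is `p`,
  -- then `b = x p`.
  let e : ℝ → A := fun x => cfc (fun y : ℝ => if y = x then (1 : ℝ) else 0) b
  have hfin := finite_spectrum_real b
  have hcont : ∀ f : ℝ → ℝ, ContinuousOn f (spectrum ℝ b) := fun f => hfin.continuousOn f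
  have hcomm : Commute b p := hbp.trans hpb.symm
  have he : ∀ x, Commute (e x) p := fun x => hcomm.cfc_real _
  have he' : ∀ x, IsStarProjection (e x) := fun x => by
    refine ⟨?_, IsSelfAdjoint.cfc⟩
    change cfc _ b * cfc _ b = cfc _ b
    rw [← cfc_mul _ _ b (hcont _) (hcont _)]
    congr 1
    ext y
    split_ifs <;> simp
  have hsum : ∑ x ∈ hfin.toFinset, e x = 1 := by
    rw [← cfc_sum _ b _ fun x _ => hcont _, ← cfc_one ℝ b hb]
    refine cfc_congr fun y hy => ?_
    simp [Finset.sum_ite_eq, hfin.mem_toFinset.mpr hy]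
  have hbe : ∀ x, b * e x = x • e x := fun x => by
    conv_lhs => rw [← cfc_id ℝ b hb]
    rw [← cfc_mul _ _ b (hcont _) (hcont _), ← cfc_smul x _ b (hcont _)]
    congr 1
    ext y
    by_cases h : y = x <;> simp [h]
  have hq : ∀ x, e x * p = 0 ∨ e x * p = p := fun x => by
    refine hmin _ ⟨?_, ?_⟩ (by rw [mul_assoc, hp.isIdempotentElem.eq])
    · exact (he' x).isIdempotentElem.mul_of_commute (he x) hp.isIdempotentElem
    · exact ((he' x).isSelfAdjoint.commute_iff hp.isSelfAdjoint).mp (he x)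
  by_cases h0 : ∀ x, e x * p = 0
  · have hp0 : p = 0 := by
      rw [← one_mul p, ← hsum, Finset.sum_mul]
      exact Finset.sum_eq_zero fun x _ => h0 x
    exact ⟨0, by rw [← hpb, hp0]; simp⟩
  · push Not at h0
    obtain ⟨x, hx⟩ := h0
    have hx' := (hq x).resolve_left hx
    refine ⟨x, ?_⟩
    rw [← hbp, ← hx', ← mul_assoc, hbe, smul_mul_assoc]

/-- If a projection has no nontrivial subprojection, then its corner is trivial. -/
theorem exists_eq_smul_of_minimal [FiniteDimensional ℂ A] {p : A} (hp : IsStarProjection p)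
    (hmin : ∀ q : A, IsStarProjection q → q * p = q → q = 0 ∨ q = p) (a : A) :
    ∃ z : ℂ, p * a * p = z • p := by
  have key : ∀ b : A, IsSelfAdjoint b → ∃ z : ℝ, p * b * p = z • p := fun b hb => by
    refine exists_eq_smul_of_isSelfAdjoint hp hmin ?_ ?_ ?_
    · rw [IsSelfAdjoint, star_mul, star_mul, hb.star_eq, hp.isSelfAdjoint.star_eq, mul_assoc]
    · rw [← mul_assoc, ← mul_assoc, hp.isIdempotentElem.eq]
    · rw [mul_assoc, hp.isIdempotentElem.eq]
  obtain ⟨x, hx⟩ := key _ (realPart a).2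
  obtain ⟨y, hy⟩ := key _ (imaginaryPart a).2
  refine ⟨x + Complex.I * y, ?_⟩
  rw [← realPart_add_I_smul_imaginaryPart a, mul_add, add_mul, hx, mul_smul_comm, smul_mul_assoc,
    hy, add_smul, mul_smul]
  rfl

/-- In a finite-dimensional C*-algebra, the unit is a sum of finitely many minimal projections. -/
theorem exists_minimal_decomposition [FiniteDimensional ℂ A] :
    ∃ (n : ℕ) (p : Fin n → A), (∀ i, IsStarProjection (p i)) ∧ (∀ i, p i ≠ 0) ∧ ∑ i, p i = 1 ∧
      ∀ i a, ∃ z : ℂ, p i * a * p i = z • p i := by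
  classical
  -- Decompositions of the unit into `n` nonzero projections. These are orthogonal, hence linearly
  -- independent, so there is a longest one; a proper subprojection of one of its members would
  -- lengthen it.
  let P : ℕ → Prop := fun n => ∃ p : Fin n → A,
    (∀ i, IsStarProjection (p i)) ∧ (∀ i, p i ≠ 0) ∧ ∑ i, p i = 1
  have hbound : ∀ n, P n → n ≤ Module.finrank ℂ A := by
    rintro n ⟨p, hp, hp0, hsum⟩
    have hli : LinearIndependent ℂ p := by
      rw [Fintype.linearIndependent_iff]
      intro g hg i
      have h := congrArg (fun x => x * p i) hg
      simp only [Finset.sum_mul, smul_mul_assoc, zero_mul] at h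
      rw [Finset.sum_eq_single i (fun j _ hj => by
        rw [IsStarProjection.mul_eq_zero_of_sum hp hsum hj, smul_zero]) (by simp),
        (hp i).isIdempotentElem.eq] at h
      exact (smul_eq_zero.mp h).resolve_right (hp0 i)
    simpa using hli.fintype_card_le_finrank
  have hne : ∃ n, P n := by
    by_cases h : (1 : A) = 0
    -- The zero algebra, which arises from zero objects, has the empty decomposition.
    · exact ⟨0, fun _ => 0, fun i => i.elim0, fun i => i.elim0, by simp [h]⟩
    · exact ⟨1, fun _ => 1, fun _ => IsStarProjection.one _, fun _ => h, by simp⟩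
  obtain ⟨m, hm⟩ := hne
  have hN := Nat.findGreatest_spec (P := P) (hbound m hm) hm
  set N := Nat.findGreatest P (Module.finrank ℂ A) with hNdef
  have hmax : ¬ P (N + 1) := fun h =>
    absurd (Nat.le_findGreatest (hbound _ h) h) (by omega)
  obtain ⟨p, hp, hp0, hsum⟩ := hN
  refine ⟨N, p, hp, hp0, hsum, fun i a => exists_eq_smul_of_minimal (hp i) (fun q hq hqp => ?_) a⟩
  by_contra! hcon
  have hpq : p i * q = q := by
    have h := congrArg star hqp
    rwa [star_mul, hq.isSelfAdjoint.star_eq, (hp i).isSelfAdjoint.star_eq] at h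
  refine hmax ⟨Fin.cons q (Function.update p i (p i - q)), fun j => ?_, fun j => ?_, ?_⟩
  · refine Fin.cases hq (fun j => ?_) j
    rw [Fin.cons_succ]
    by_cases hj : j = i
    · subst hj
      rw [Function.update_self]
      refine ⟨?_, (hp j).isSelfAdjoint.sub hq.isSelfAdjoint⟩
      rw [IsIdempotentElem, mul_sub, sub_mul, sub_mul, hqp, hpq, (hp j).isIdempotentElem.eq,
        hq.isIdempotentElem.eq, sub_self, sub_zero]
    · rw [Function.update_of_ne hj]
      exact hp j
  · refine Fin.cases hcon.1 (fun j => ?_) j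
    rw [Fin.cons_succ]
    by_cases hj : j = i
    · subst hj
      rw [Function.update_self]
      exact sub_ne_zero.mpr hcon.2.symm
    · rw [Function.update_of_ne hj]
      exact hp0 j
  · rw [Fin.sum_univ_succ, Fin.cons_zero]
    simp only [Fin.cons_succ]
    rw [Finset.sum_update_of_mem (Finset.mem_univ i), ← hsum,
      ← Finset.add_sum_erase _ _ (Finset.mem_univ i), Finset.sdiff_singleton_eq_erase]
    abel

/-- Orthogonal idempotents adding up to the unit are simultaneously similar to projections. -/
theorem exists_isUnit_conj_isSelfAdjoint {ι : Type*} [Fintype ι] {e : ι → A}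
    (he : ∀ i, e i * e i = e i) (he' : ∀ i j, i ≠ j → e i * e j = 0) (hsum : ∑ i, e i = 1) :
    ∃ a : Aˣ, ∀ i, IsSelfAdjoint ((↑a⁻¹ : A) * e i * a) := by
  classical
  let _ := CStarAlgebra.spectralOrder A
  have _ := CStarAlgebra.spectralOrderedRing A
  -- Orthogonality gives `e i * G = e i * star (e i) = G * star (e i)`, so conjugation by the square
  -- root of `G` makes every `e i` self-adjoint.
  set G := ∑ i, e i * star (e i) with hG
  have hG0 : 0 ≤ G := Finset.sum_nonneg fun i _ => mul_star_self_nonneg _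
  have hsum' : ∑ i, star (e i) = 1 := by rw [← star_sum, hsum, star_one]
  have hGu : IsUnit G := by
    -- This positive sum bounds `G` below by the inverse of the number of idempotents, hence `G` is
    -- invertible.
    have h : ∑ i, ∑ j, (e i - e j) * star (e i - e j) =
        (2 : ℝ) • ((Fintype.card ι : ℝ) • G - 1) := by
      have hexp : ∀ i j, (e i - e j) * star (e i - e j) =
          e i * star (e i) - e i * star (e j) - e j * star (e i) + e j * star (e j) := by
        intro i j
        rw [star_sub]
        noncomm_ring
      simp only [hexp, Finset.sum_add_distrib, Finset.sum_sub_distrib, ← Finset.mul_sum,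
        ← Finset.sum_mul, hsum, hsum', Finset.sum_const, Finset.card_univ, mul_one, one_mul]
      simp only [mul_smul_comm, ← Finset.smul_sum]
      rw [← hG, two_smul, Nat.cast_smul_eq_nsmul]
      abel
    have h1 : (0 : A) ≤ (2 : ℝ) • ((Fintype.card ι : ℝ) • G - 1) := by
      rw [← h]
      exact Finset.sum_nonneg fun i _ => Finset.sum_nonneg fun j _ => mul_star_self_nonneg _
    have h2 : (1 : A) ≤ (Fintype.card ι : ℝ) • G := by
      have := smul_nonneg (by norm_num : (0 : ℝ) ≤ 1 / 2) h1
      rw [smul_smul] at this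
      norm_num at this
      exact this
    have h3 : IsUnit ((Fintype.card ι : ℝ) • G) := isUnit_of_le 1 h2
    by_cases hcard : (Fintype.card ι : ℝ) = 0
    · rw [hcard, zero_smul] at h3
      have := isUnit_zero_iff.mp h3
      have : Subsingleton A := subsingleton_of_zero_eq_one this
      exact isUnit_of_subsingleton _
    · exact (isUnit_smul_iff (Units.mk0 _ hcard) G).mp h3
  have hGe : ∀ i, G * star (e i) = e i * G := by
    intro i
    rw [hG, Finset.sum_mul, Finset.mul_sum]
    refine Finset.sum_congr rfl fun j _ => ?_
    by_cases hij : i = j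
    · subst hij
      rw [mul_assoc, ← star_mul, he, ← mul_assoc, he]
    · rw [mul_assoc, ← star_mul, he' i j hij, star_zero, mul_zero, ← mul_assoc, he' i j hij,
        zero_mul]
  obtain ⟨a, ha⟩ := (CFC.isUnit_sqrt_iff G hG0).mpr hGu
  have ha1 : star (a : A) = a := by
    rw [ha]
    exact (IsSelfAdjoint.of_nonneg (CFC.sqrt_nonneg G)).star_eq
  have ha2 : (a : A) * a = G := by rw [ha, CFC.sqrt_mul_sqrt_self G hG0]
  have ha3 : star (↑a⁻¹ : A) = ↑a⁻¹ := by
    have h : star (↑a⁻¹ : A) * a = 1 := by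
      conv_lhs => rw [← ha1]
      rw [← star_mul, Units.mul_inv, star_one]
    rw [← mul_one (star _), ← a.mul_inv, ← mul_assoc, h, one_mul]
  refine ⟨a, fun i => ?_⟩
  rw [IsSelfAdjoint, star_mul, star_mul, ha1, ha3]
  have h := congrArg (fun x => (↑a⁻¹ : A) * x * ↑a⁻¹) (hGe i)
  simp only [← ha2, mul_assoc, Units.inv_mul_cancel_left, Units.mul_inv, mul_one] at h
  rw [h, mul_assoc]

end CStarAlgebra

/-! ### Finite dimensionality of the spaces of arrows -/

section FiniteDimensional

variable {C : Type u} [Category.{v} C] [MonoidalCategory C] [TensorCStarCategory C]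

/-- Isometries `ι → Z` with mutually orthogonal ranges. -/
def IsOrthonormalFamily {Z : C} {n : ℕ} (w : Fin n → (𝟙_ C ⟶ Z)) : Prop :=
  ∀ i j, w i ≫ adj (w j) = if i = j then 𝟙 (𝟙_ C) else 0

/-- Bessel's inequality. -/
theorem HasIrreducibleUnit.sum_norm_sq_le (hunit : HasIrreducibleUnit C) {V V' : C}
    (y : 𝟙_ C ⟶ V) {n : ℕ} (Q : Fin n → (V ⟶ V'))
    (hQ : IsProjectionArrow (∑ i, Q i ≫ adj (Q i))) : ∑ i, ‖y ≫ Q i‖ ^ 2 ≤ ‖y‖ ^ 2 := by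
  set P := ∑ i, Q i ≫ adj (Q i) with hP
  have h₁ : y ≫ P ≫ adj y = ((∑ i, ‖y ≫ Q i‖ ^ 2 : ℝ) : ℂ) • 𝟙 (𝟙_ C) := by
    rw [hP, Preadditive.sum_comp, Preadditive.comp_sum, Complex.ofReal_sum, Finset.sum_smul]
    refine Finset.sum_congr rfl fun i _ => ?_
    rw [← hunit.comp_adj_eq, adj_comp]
    simp only [Category.assoc]
  have h₂ : (y ≫ (𝟙 V - P)) ≫ adj (y ≫ (𝟙 V - P)) = y ≫ adj y - y ≫ P ≫ adj y := by
    have : (𝟙 V - P) ≫ (𝟙 V - P) = 𝟙 V - P := by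
      rw [Preadditive.comp_sub, Preadditive.sub_comp _ _ P, hQ.1, Category.id_comp, sub_self, sub_zero,
        Category.comp_id]
    rw [adj_comp, adj_sub, adj_id, hQ.2, Category.assoc, ← Category.assoc (𝟙 V - P), this,
      Preadditive.sub_comp, Preadditive.comp_sub, Category.id_comp]
  rw [hunit.comp_adj_eq, hunit.comp_adj_eq, h₁, ← sub_smul] at h₂
  have h₃ := hunit.smul_injective h₂
  rw [← Complex.ofReal_sub, Complex.ofReal_inj] at h₃
  nlinarith [sq_nonneg ‖y ≫ (𝟙 V - P)‖]

namespace IsOrthonormalFamily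

variable {Z : C} {n : ℕ} {w : Fin n → (𝟙_ C ⟶ Z)}

theorem isProjectionArrow (hw : IsOrthonormalFamily w) :
    IsProjectionArrow (∑ i, adj (w i) ≫ w i) := by
  constructor
  · rw [Preadditive.sum_comp]
    refine Finset.sum_congr rfl fun i _ => ?_
    rw [Preadditive.comp_sum, Finset.sum_eq_single i]
    · rw [Category.assoc, ← Category.assoc (w i), hw, if_pos rfl, Category.id_comp]
    · intro j _ hj
      rw [Category.assoc, ← Category.assoc (w i), hw, if_neg hj.symm, Limits.zero_comp,
        Limits.comp_zero]
    · simp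
  · rw [adj_sum]
    refine Finset.sum_congr rfl fun i _ => ?_
    rw [adj_comp, adj_adj]

/-- The zigzag writes `w i* w i = 1` as a pairing of `(1 × w i*) R` with `(w i* × 1) Rbar`. The
product of their norms is therefore at least `1` and the sum of squares at least `2`; Bessel's
inequality bounds the total over `i`. -/
theorem card_le (hunit : HasIrreducibleUnit C) (s : ConjugateSolution Z)
    (hw : IsOrthonormalFamily w) : 2 * (n : ℝ) ≤ ‖s.R‖ ^ 2 + ‖s.Rbar‖ ^ 2 := by
  have hP := hw.isProjectionArrow
  have h₁ : ∑ i, ‖s.R ≫ s.bar ◁ adj (w i)‖ ^ 2 ≤ ‖s.R‖ ^ 2 := by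
    refine hunit.sum_norm_sq_le s.R _ ?_
    have e : ∑ i, s.bar ◁ adj (w i) ≫ adj (s.bar ◁ adj (w i)) =
        s.bar ◁ ∑ i, adj (w i) ≫ w i := by
      rw [whiskerLeft_sum]
      simp only [adj_whiskerLeft, adj_adj, whiskerLeft_comp]
    rw [e]
    exact ⟨by rw [← whiskerLeft_comp, hP.1], by rw [adj_whiskerLeft, hP.2]⟩
  have h₂ : ∑ i, ‖s.Rbar ≫ adj (w i) ▷ s.bar‖ ^ 2 ≤ ‖s.Rbar‖ ^ 2 := by
    refine hunit.sum_norm_sq_le s.Rbar _ ?_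
    have e : ∑ i, adj (w i) ▷ s.bar ≫ adj (adj (w i) ▷ s.bar) =
        (∑ i, adj (w i) ≫ w i) ▷ s.bar := by
      rw [sum_whiskerRight]
      simp only [adj_whiskerRight, adj_adj, comp_whiskerRight]
    rw [e]
    exact ⟨by rw [← comp_whiskerRight, hP.1], by rw [adj_whiskerRight, hP.2]⟩
  have h₃ : ∀ i, 2 ≤ ‖s.R ≫ s.bar ◁ adj (w i)‖ ^ 2 + ‖s.Rbar ≫ adj (w i) ▷ s.bar‖ ^ 2 := by
    intro i
    have e : w i ≫ adj (w i) = (s.R ≫ s.bar ◁ adj (w i)) ≫ (ρ_ s.bar).hom ≫ (λ_ s.bar).inv ≫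
        adj (s.Rbar ≫ adj (w i) ▷ s.bar) := by
      rw [adj_comp, adj_whiskerRight, adj_adj]
      calc
        w i ≫ adj (w i) = 𝟙 _ ⊗≫ w i ▷ 𝟙_ C ⊗≫ (Z ◁ s.R ⊗≫ adj s.Rbar ▷ Z) ⊗≫ adj (w i) := by
          rw [s.snake_ev]; monoidal
        _ = 𝟙 _ ⊗≫ (w i ▷ 𝟙_ C ≫ Z ◁ s.R) ⊗≫ (adj s.Rbar ▷ Z ≫ 𝟙_ C ◁ adj (w i)) ⊗≫ 𝟙 _ := by
          monoidal
        _ = 𝟙 _ ⊗≫ (𝟙_ C ◁ s.R) ⊗≫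
            (w i ▷ s.bar ▷ Z ≫ (Z ⊗ s.bar) ◁ adj (w i)) ⊗≫ (adj s.Rbar ▷ 𝟙_ C) ⊗≫ 𝟙 _ := by
          rw [← whisker_exchange, ← whisker_exchange]; monoidal
        _ = 𝟙 _ ⊗≫ (𝟙_ C ◁ s.R) ⊗≫
            ((𝟙_ C ⊗ s.bar) ◁ adj (w i) ≫ (w i ▷ s.bar) ▷ 𝟙_ C) ⊗≫ (adj s.Rbar ▷ 𝟙_ C) ⊗≫ 𝟙 _ := by
          rw [whisker_exchange]
        _ = _ := by monoidal
    have h1 : ‖w i ≫ adj (w i)‖ = 1 := by rw [hw, if_pos rfl, hunit.norm_id]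
    have hr : ‖(ρ_ s.bar).hom‖ ≤ 1 :=
      norm_le_one_of_comp_adj (by rw [adj_rightUnitor, Iso.hom_inv_id])
    have hl : ‖(λ_ s.bar).inv‖ ≤ 1 :=
      norm_le_one_of_comp_adj (by rw [adj_leftUnitor_inv, Iso.inv_hom_id])
    have h2 : 1 ≤ ‖s.R ≫ s.bar ◁ adj (w i)‖ * ‖s.Rbar ≫ adj (w i) ▷ s.bar‖ := by
      calc
        1 = _ := (h1.symm.trans (congrArg norm e))
        _ ≤ ‖s.R ≫ s.bar ◁ adj (w i)‖ * (1 * (1 * ‖s.Rbar ≫ adj (w i) ▷ s.bar‖)) := by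
          refine (norm_comp_le _ _).trans ?_
          gcongr
          refine (norm_comp_le _ _).trans ?_
          gcongr
          refine (norm_comp_le _ _).trans ?_
          rw [norm_adj]
          gcongr
        _ = _ := by ring
    nlinarith [sq_nonneg (‖s.R ≫ s.bar ◁ adj (w i)‖ - ‖s.Rbar ≫ adj (w i) ▷ s.bar‖)]
  have h₄ := Finset.sum_le_sum fun i (_ : i ∈ Finset.univ) => h₃ i
  rw [Finset.sum_add_distrib, Finset.sum_const, Finset.card_univ, Fintype.card_fin,
    nsmul_eq_mul] at h₄
  linarith

/-- Gram–Schmidt: the normalized remainder of `x` is a new member. -/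
theorem exists_cons (hunit : HasIrreducibleUnit C) (hw : IsOrthonormalFamily w) {x : 𝟙_ C ⟶ Z}
    (hx : x ≠ ∑ i, (x ≫ adj (w i)) ≫ w i) :
    ∃ w' : Fin (n + 1) → (𝟙_ C ⟶ Z), IsOrthonormalFamily w' := by
  set y := x - ∑ i, (x ≫ adj (w i)) ≫ w i with hy
  have hy0 : ‖y‖ ≠ 0 := norm_ne_zero_iff.mpr (sub_ne_zero.mpr hx)
  have horth : ∀ j, y ≫ adj (w j) = 0 := fun j => by
    rw [hy, Preadditive.sub_comp, Preadditive.sum_comp, Finset.sum_eq_single j]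
    · rw [Category.assoc, hw, if_pos rfl, Category.comp_id, sub_self]
    · intro i _ hij
      rw [Category.assoc, hw, if_neg hij, Limits.comp_zero]
    · simp
  have horth' : ∀ j, w j ≫ adj y = 0 := fun j => by
    have h := congrArg adj (horth j)
    rwa [adj_comp, adj_adj, adj_zero] at h
  refine ⟨Fin.cons (((‖y‖⁻¹ : ℝ) : ℂ) • y) w, fun i j => ?_⟩
  refine Fin.cases ?_ (fun i => ?_) i <;> refine Fin.cases ?_ (fun j => ?_) j
  · rw [Fin.cons_zero, adj_smul, CStarCategory.smul_comp, CStarCategory.comp_smul, if_pos rfl,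
      hunit.comp_adj_eq, smul_smul, smul_smul, Complex.conj_ofReal, ← Complex.ofReal_mul,
      ← Complex.ofReal_mul]
    have : ‖y‖⁻¹ * ‖y‖⁻¹ * ‖y‖ ^ 2 = 1 := by field_simp
    rw [this, Complex.ofReal_one, one_smul]
  · rw [Fin.cons_zero, Fin.cons_succ, CStarCategory.smul_comp, horth, smul_zero,
      if_neg (Fin.succ_ne_zero j).symm]
  · rw [Fin.cons_zero, Fin.cons_succ, adj_smul, CStarCategory.comp_smul, horth', smul_zero,
      if_neg (Fin.succ_ne_zero i)]
  · simp only [Fin.cons_succ, Fin.succ_inj]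
    exact hw i j

end IsOrthonormalFamily

theorem exists_orthonormal_expansion (hunit : HasIrreducibleUnit C) {Z : C}
    (s : ConjugateSolution Z) :
    ∃ (n : ℕ) (w : Fin n → (𝟙_ C ⟶ Z)), ∀ x : 𝟙_ C ⟶ Z, x = ∑ i, (x ≫ adj (w i)) ≫ w i := by
  by_contra! hcon
  have h : ∀ n : ℕ, ∃ w : Fin n → (𝟙_ C ⟶ Z), IsOrthonormalFamily w := by
    intro n
    induction n with
    | zero => exact ⟨fun _ => 0, fun i => i.elim0⟩
    | succ n ih =>
      obtain ⟨w, hw⟩ := ih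
      obtain ⟨x, hx⟩ := hcon n w
      exact hw.exists_cons hunit hx
  obtain ⟨n, hn⟩ := exists_nat_gt (‖s.R‖ ^ 2 + ‖s.Rbar‖ ^ 2)
  obtain ⟨w, hw⟩ := h n
  have := hw.card_le hunit s
  have hn0 : (0 : ℝ) ≤ n := n.cast_nonneg
  linarith

theorem finiteDimensional_unit_hom (hunit : HasIrreducibleUnit C) {Z : C}
    (s : ConjugateSolution Z) : FiniteDimensional ℂ (𝟙_ C ⟶ Z) := by
  obtain ⟨n, w, hw⟩ := exists_orthonormal_expansion hunit s
  refine Module.Finite.of_surjective (Fintype.linearCombination ℂ w) fun x => ?_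
  choose a ha using fun i => hunit.2 (x ≫ adj (w i))
  refine ⟨a, ?_⟩
  rw [Fintype.linearCombination_apply, hw x]
  exact Finset.sum_congr rfl fun i _ => by rw [ha, smul_id_comp]

/-- Frobenius reciprocity embeds `(X, X)` in `(ι, X ⊗ bar)`, and `X ⊗ bar` has a conjugate, by the
product of `s` with its reverse. -/
theorem finiteDimensional_end (hunit : HasIrreducibleUnit C) {X : C} (s : ConjugateSolution X) :
    FiniteDimensional ℂ (EndAlg C X) := by
  have := finiteDimensional_unit_hom hunit (s.tensor s.rev)
  let φ : EndAlg C X →ₗ[ℂ] (𝟙_ C ⟶ X ⊗ s.bar) :=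
    { toFun := fun f => s.Rbar ≫ (show X ⟶ X from f) ▷ s.bar
      map_add' := fun f g => by
        refine (congrArg _ (MonoidalPreadditive.add_whiskerRight (show X ⟶ X from f) g)).trans ?_
        exact CStarCategory.comp_add _ _ _
      map_smul' := fun a f => by
        refine (congrArg _ (MonoidalLinear.smul_whiskerRight a (show X ⟶ X from f) s.bar)).trans ?_
        exact CStarCategory.comp_smul _ _ _ }
  exact FiniteDimensional.of_injective φ fun f g h => s.rev.hom_ext h

end FiniteDimensional

/-! ### Existence of standard solutions -/

namespace ConjugateSolution

variable {C : Type u} [Category.{v} C] [MonoidalCategory C] [TensorCStarCategory C] {X : C}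

/-- Changing a solution by an invertible endomorphism of the conjugate. -/
def twist (s : ConjugateSolution X) (T T' : s.bar ⟶ s.bar) (h : T ≫ T' = 𝟙 _)
    (h' : T' ≫ T = 𝟙 _) : ConjugateSolution X where
  bar := s.bar
  R := s.R ≫ T ▷ X
  Rbar := s.Rbar ≫ X ◁ adj T'
  conj_eq := by
    rw [adj_comp, adj_whiskerLeft, adj_adj]
    calc
      _ = (ρ_ X).inv ≫ X ◁ s.R ≫ (α_ X s.bar X).inv ≫ (X ◁ (T ≫ T')) ▷ X ≫ adj s.Rbar ▷ X ≫
          (λ_ X).hom := by monoidal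
      _ = 𝟙 X := by
        rw [h, whiskerLeft_id, id_whiskerRight, Category.id_comp, s.conj_eq]
  conj_eq_bar := by
    rw [adj_comp, adj_whiskerRight]
    calc
      _ = (ρ_ s.bar).inv ≫ s.bar ◁ s.Rbar ≫ (s.bar ◁ X ◁ adj T' ≫ adj T ▷ (X ⊗ s.bar)) ≫
          (α_ s.bar X s.bar).inv ≫ adj s.R ▷ s.bar ≫ (λ_ s.bar).hom := by monoidal
      _ = 𝟙 _ ⊗≫ (s.bar ◁ s.Rbar ≫ adj T ▷ (X ⊗ s.bar)) ⊗≫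
          ((s.bar ⊗ X) ◁ adj T' ≫ adj s.R ▷ s.bar) ⊗≫ 𝟙 _ := by
        rw [whisker_exchange]; monoidal
      _ = adj T ≫ ((ρ_ s.bar).inv ≫ s.bar ◁ s.Rbar ≫ (α_ s.bar X s.bar).inv ≫ adj s.R ▷ s.bar ≫
          (λ_ s.bar).hom) ≫ adj T' := by
        rw [whisker_exchange, whisker_exchange]; monoidal
      _ = 𝟙 _ := by
        rw [s.conj_eq_bar, Category.id_comp, ← adj_comp, h', adj_id]

/-- The projection `E` on `X` corresponds to the projection `F` on the conjugate. -/
def Corresponds (s : ConjugateSolution X) (E : X ⟶ X) (F : s.bar ⟶ s.bar) : Prop :=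
  s.R ≫ F ▷ X = s.R ≫ s.bar ◁ E ∧ s.Rbar ≫ X ◁ F = s.Rbar ≫ E ▷ s.bar

/-- Before the twist, `R` and `Rbar` may match `E` with different idempotents `F` and `F'`; a twist
intertwining both with one `G` repairs this. -/
theorem Corresponds.twist {s : ConjugateSolution X} {E : X ⟶ X} {F F' : s.bar ⟶ s.bar}
    {T T' : s.bar ⟶ s.bar} {h : T ≫ T' = 𝟙 _} {h' : T' ≫ T = 𝟙 _}
    (hR : s.R ≫ F ▷ X = s.R ≫ s.bar ◁ E) (hRbar : s.Rbar ≫ X ◁ F' = s.Rbar ≫ E ▷ s.bar)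
    {G : s.bar ⟶ s.bar} (hG : T ≫ G = F ≫ T) (hG' : adj T' ≫ G = F' ≫ adj T') :
    (s.twist T T' h h').Corresponds E G := by
  constructor
  · change (s.R ≫ T ▷ X) ≫ G ▷ X = (s.R ≫ T ▷ X) ≫ s.bar ◁ E
    rw [Category.assoc, ← comp_whiskerRight, hG, comp_whiskerRight, reassoc_of% hR,
      whisker_exchange, Category.assoc]
  · change (s.Rbar ≫ X ◁ adj T') ≫ X ◁ G = (s.Rbar ≫ X ◁ adj T') ≫ E ▷ s.bar
    rw [Category.assoc, ← whiskerLeft_comp, hG', whiskerLeft_comp, reassoc_of% hRbar,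
      ← whisker_exchange, Category.assoc]

theorem Corresponds.R_tensor {s : ConjugateSolution X} {E : X ⟶ X} {F : s.bar ⟶ s.bar}
    (h : s.Corresponds E F) (hE : E ≫ E = E) : s.R ≫ (F ⊗ₘ E) = s.R ≫ s.bar ◁ E := by
  rw [MonoidalCategory.tensorHom_def, reassoc_of% h.1, ← whiskerLeft_comp, hE]

theorem Corresponds.Rbar_tensor {s : ConjugateSolution X} {E : X ⟶ X} {F : s.bar ⟶ s.bar}
    (h : s.Corresponds E F) (hE : E ≫ E = E) : s.Rbar ≫ (E ⊗ₘ F) = s.Rbar ≫ E ▷ s.bar := by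
  rw [tensorHom_def', reassoc_of% h.2, ← comp_whiskerRight, hE]

theorem isStandard_of_corresponds {s : ConjugateSolution X} {n : ℕ} {E : Fin n → (X ⟶ X)}
    {F : Fin n → (s.bar ⟶ s.bar)} (hE : ∀ i, IsMinimalProjectionArrow (E i))
    (hF : ∀ i, IsProjectionArrow (F i)) (hE1 : ∑ i, E i = 𝟙 X) (hF1 : ∑ i, F i = 𝟙 s.bar)
    (h : ∀ i, s.Corresponds (E i) (F i))
    (hnorm : ∀ i, ‖s.R ≫ s.bar ◁ E i‖ = ‖s.Rbar ≫ E i ▷ s.bar‖) : s.IsStandard := by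
  refine ⟨n, E, F, hE, hF, hE1, hF1, ?_, ?_, fun i => ?_⟩
  · simp only [fun i => (h i).R_tensor (hE i).1.1]
    rw [← Preadditive.comp_sum, ← whiskerLeft_sum, hE1, whiskerLeft_id, Category.comp_id]
  · simp only [fun i => (h i).Rbar_tensor (hE i).1.1]
    rw [← Preadditive.comp_sum, ← sum_whiskerRight, hE1, id_whiskerRight, Category.comp_id]
  · rw [(h i).R_tensor (hE i).1.1, (h i).Rbar_tensor (hE i).1.1, hnorm]

theorem exists_isStandard_of_corresponds {s : ConjugateSolution X} {n : ℕ} {E : Fin n → (X ⟶ X)}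
    {F : Fin n → (s.bar ⟶ s.bar)} (hE : ∀ i, IsMinimalProjectionArrow (E i))
    (hF : ∀ i, IsProjectionArrow (F i)) (hE1 : ∑ i, E i = 𝟙 X) (hF1 : ∑ i, F i = 𝟙 s.bar)
    (h : ∀ i, s.Corresponds (E i) (F i)) : ∃ t : ConjugateSolution X, t.IsStandard := by
  have hr : ∀ i, 0 < ‖s.R ≫ s.bar ◁ E i‖ := fun i =>
    norm_pos_iff.mpr fun h0 => (hE i).2.1 (R_whiskerLeft_eq_zero h0)
  have hr' : ∀ i, 0 < ‖s.Rbar ≫ E i ▷ s.bar‖ := fun i => by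
    refine norm_pos_iff.mpr fun h0 => (hE i).2.1 (s.rev.hom_ext (h0.trans ?_))
    rw [MonoidalPreadditive.zero_whiskerRight, Limits.comp_zero]
  have hFF : ∀ i j, i ≠ j → F i ≫ F j = 0 := fun i j => IsProjectionArrow.comp_eq_zero hF hF1
  -- The twist by `∑ i, b i • F i` multiplies the `i`-th summand of `R` by `b i` and that of `Rbar`
  -- by its inverse. This value of `b i` equalizes the norms.
  let b : Fin n → ℝ := fun i => Real.sqrt (‖s.Rbar ≫ E i ▷ s.bar‖ / ‖s.R ≫ s.bar ◁ E i‖)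
  have hb : ∀ i, 0 < b i := fun i => Real.sqrt_pos.mpr (div_pos (hr' i) (hr i))
  let D : (Fin n → ℝ) → (s.bar ⟶ s.bar) := fun a => ∑ i, (a i : ℂ) • F i
  have hDF : ∀ a i, D a ≫ F i = (a i : ℂ) • F i := fun a i => by
    rw [Preadditive.sum_comp, Finset.sum_eq_single i]
    · rw [CStarCategory.smul_comp, (hF i).1]
    · intro j _ hj
      rw [CStarCategory.smul_comp, hFF j i hj, smul_zero]
    · simp
  have hFD : ∀ a i, F i ≫ D a = (a i : ℂ) • F i := fun a i => by
    rw [Preadditive.comp_sum, Finset.sum_eq_single i]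
    · rw [CStarCategory.comp_smul, (hF i).1]
    · intro j _ hj
      rw [CStarCategory.comp_smul, hFF i j hj.symm, smul_zero]
    · simp
  have hDD : ∀ a a' : Fin n → ℝ, (∀ i, a i * a' i = 1) → D a ≫ D a' = 𝟙 _ := fun a a' haa => by
    change D a ≫ ∑ i, (a' i : ℂ) • F i = _
    rw [Preadditive.comp_sum, ← hF1]
    refine Finset.sum_congr rfl fun i _ => ?_
    rw [CStarCategory.comp_smul, hDF, smul_smul, ← Complex.ofReal_mul, mul_comm, haa,
      Complex.ofReal_one, one_smul]
  have hDadj : ∀ a, adj (D a) = D a := fun a => by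
    change adj (∑ i, (a i : ℂ) • F i) = ∑ i, (a i : ℂ) • F i
    rw [adj_sum]
    refine Finset.sum_congr rfl fun i _ => ?_
    rw [adj_smul, (hF i).2, Complex.conj_ofReal]
  let t := s.twist (D b) (D fun i => (b i)⁻¹)
    (hDD _ _ fun i => mul_inv_cancel₀ (hb i).ne') (hDD _ _ fun i => inv_mul_cancel₀ (hb i).ne')
  have ht : ∀ i, t.Corresponds (E i) (F i) := fun i =>
    Corresponds.twist (h i).1 (h i).2 (by rw [hDF, hFD]) (by rw [hDadj, hDF, hFD])
  refine ⟨t, isStandard_of_corresponds hE hF hE1 hF1 ht fun i => ?_⟩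
  have h₁ : ‖t.R ≫ t.bar ◁ E i‖ = b i * ‖s.R ≫ s.bar ◁ E i‖ := by
    rw [← (ht i).1]
    change ‖(s.R ≫ D b ▷ X) ≫ F i ▷ X‖ = _
    rw [Category.assoc, ← comp_whiskerRight, hDF, MonoidalLinear.smul_whiskerRight,
      CStarCategory.comp_smul, (h i).1, norm_smul, Complex.norm_real,
      Real.norm_of_nonneg (hb i).le]
  have h₂ : ‖t.Rbar ≫ E i ▷ t.bar‖ = (b i)⁻¹ * ‖s.Rbar ≫ E i ▷ s.bar‖ := by
    rw [← (ht i).2]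
    change ‖(s.Rbar ≫ X ◁ adj (D fun i => (b i)⁻¹)) ≫ X ◁ F i‖ = _
    rw [Category.assoc, ← whiskerLeft_comp, hDadj, hDF, MonoidalLinear.whiskerLeft_smul,
      CStarCategory.comp_smul, (h i).2, norm_smul, Complex.norm_real,
      Real.norm_of_nonneg (inv_nonneg.mpr (hb i).le)]
  rw [h₁, h₂, inv_mul_eq_div, eq_div_iff (hb i).ne']
  have hbb : b i * b i = ‖s.Rbar ≫ E i ▷ s.bar‖ / ‖s.R ≫ s.bar ◁ E i‖ :=
    Real.mul_self_sqrt (div_pos (hr' i) (hr i)).le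
  rw [mul_right_comm, hbb, div_mul_cancel₀ _ (hr i).ne']

theorem exists_isStandard (hunit : HasIrreducibleUnit C) (s : ConjugateSolution X) :
    ∃ t : ConjugateSolution X, t.IsStandard := by
  have := finiteDimensional_end hunit s
  obtain ⟨n, E, hE, hE0, hE1, hEmin⟩ := CStarAlgebra.exists_minimal_decomposition (A := EndAlg C X)
  let E' : Fin n → (X ⟶ X) := E
  have hE' : ∀ i, IsMinimalProjectionArrow (E' i) := fun i =>
    ⟨isProjectionArrow_iff.mpr (hE i), hE0 i, fun T => by
      obtain ⟨z, hz⟩ := hEmin i T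
      exact ⟨z, (Category.assoc _ _ _).symm.trans hz⟩⟩
  have hE1' : ∑ i, E' i = 𝟙 X := hE1
  have hEE : ∀ i j, i ≠ j → E' i ≫ E' j = 0 := fun i j =>
    IsProjectionArrow.comp_eq_zero (fun i => (hE' i).1) hE1'
  -- The solution `s` is arbitrary, so these idempotents need not be self-adjoint: `R` matches `E'
  -- i` with `e i`, and `Rbar` matches it with `adj (e i)`.
  let e : Fin n → (s.bar ⟶ s.bar) := fun i => conjMap s s (E' i)
  have hee : ∀ i, e i ≫ e i = e i := fun i => by
    rw [conjMap_comp_conjMap, (hE' i).1.1]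
  have hee' : ∀ i j, i ≠ j → e i ≫ e j = 0 := fun i j hij => by
    rw [conjMap_comp_conjMap, hEE i j hij, conjMap_zero]
  have he1 : ∑ i, e i = 𝟙 s.bar := by
    rw [← conjMap_id, ← hE1']
    exact (map_sum (AddMonoidHom.mk' (conjMap s s) (conjMap_add s s)) E' Finset.univ).symm
  obtain ⟨a, ha⟩ := CStarAlgebra.exists_isUnit_conj_isSelfAdjoint (A := EndAlg C s.bar)
    (e := e) hee hee' he1
  let T : s.bar ⟶ s.bar := (a : EndAlg C s.bar)
  let T' : s.bar ⟶ s.bar := (↑a⁻¹ : EndAlg C s.bar)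
  have hT : T ≫ T' = 𝟙 _ := a.mul_inv
  have hT' : T' ≫ T = 𝟙 _ := a.inv_mul
  let F : Fin n → (s.bar ⟶ s.bar) := fun i => T' ≫ e i ≫ T
  have hFadj : ∀ i, adj (F i) = F i := fun i => by
    have h : adj ((T' ≫ e i) ≫ T) = (T' ≫ e i) ≫ T := ha i
    rwa [Category.assoc] at h
  have hF : ∀ i, IsProjectionArrow (F i) := fun i => by
    refine ⟨?_, hFadj i⟩
    simp only [F, Category.assoc, reassoc_of% hT, reassoc_of% (hee i)]
  have hF1 : ∑ i, F i = 𝟙 s.bar := by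
    rw [← Preadditive.comp_sum, ← Preadditive.sum_comp, he1, Category.id_comp, hT']
  have hTadj : adj T' ≫ adj T = 𝟙 _ := by rw [← adj_comp, hT, adj_id]
  have hc : ∀ i, (s.twist T T' hT hT').Corresponds (E' i) (F i) := fun i => by
    refine Corresponds.twist (F := e i) (F' := adj (e i)) ?_ (Rbar_adj_conjMap _) ?_ ?_
    · rw [R_conjMap, (hE' i).1.2]
    · rw [reassoc_of% hT]
    · rw [← hFadj, adj_comp, adj_comp, Category.assoc, reassoc_of% hTadj]
  exact exists_isStandard_of_corresponds (s := s.twist T T' hT hT') hE' hF hE1' hF1 hc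

end ConjugateSolution

/-! ### Assembly of the theorem. -/

theorem exists_standardChoice {C : Type u} [Category.{v} C] [MonoidalCategory C]
    [TensorCStarCategory C] (hunit : HasIrreducibleUnit C) (hconj : HasConjugates C) :
    Nonempty (StandardChoice C) := by
  choose t ht using fun X : C => ConjugateSolution.exists_isStandard hunit (hconj X).some
  exact ⟨⟨t, ht⟩⟩

end

theorem theorem4p2 {C : Type u} [Category.{v} C] [MonoidalCategory C] [TensorCStarCategory C]
    (hunit : HasIrreducibleUnit C) (hconj : HasConjugates C) :
    -- standard solutions exist
    Nonempty (StandardChoice C) ∧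
    -- every choice of standard solutions defines, by the formulas, a functorial conjugation,
    -- and hence a conjugation
    (∀ S : StandardChoice C, ∃ K : FunctorialConjugation S.bar, K.IsDefinedBy S ∧
      (∀ K' : FunctorialConjugation S.bar, K'.IsDefinedBy S → K' = K) ∧
      ∃ (A : Conjugation C) (J : ∀ X : C, A.AHom X (S.bar X)), A.IsAssociatedWith K J) ∧
    -- two choices of standard solutions define the same conjugation: they are related by unique
    -- unitaries `U`, and there is a unique isomorphism over `C` taking `J'` to `U ∘ J`
    (∀ S S' : StandardChoice C,
      ∃ U : ∀ X : C, S.bar X ⟶ S'.bar X,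
        (∀ X, IsUnitaryArrow (U X) ∧ S'.R X = S.R X ≫ U X ▷ X ∧
          ∀ V : S.bar X ⟶ S'.bar X, S'.R X = S.R X ≫ V ▷ X → V = U X) ∧
        ∀ (K : FunctorialConjugation S.bar) (K' : FunctorialConjugation S'.bar)
          (A A' : Conjugation C) (J : ∀ X : C, A.AHom X (S.bar X))
          (J' : ∀ X : C, A'.AHom X (S'.bar X)),
          K.IsDefinedBy S → K'.IsDefinedBy S' →
          A.IsAssociatedWith K J → A'.IsAssociatedWith K' J' →
          ∃! Φ : Conjugation.Iso A' A, ∀ X, Φ.toEquiv X (S'.bar X) (J' X) = A.al (J X) (U X)) := by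
  refine ⟨exists_standardChoice hunit hconj, fun S => ?_, fun S S' => ?_⟩
  · have hK := S.functorialConjugation_isDefinedBy hunit
    exact ⟨S.functorialConjugation hunit, hK, fun K' hK' => hK'.unique hK,
      S.exists_conjugation hunit⟩
  · refine ⟨S.comparison S', fun X => ⟨S.comparison_unitary hunit S' X, S.R_comparison S' X,
      fun V hV => (S.sol X).hom_ext (hV.symm.trans (S.R_comparison S' X))⟩, ?_⟩
    intro K K' A A' J J' hK hK' hA hA'
    exact (StandardChoice.isAssociatedWith_comparison hunit hK hK' hA).existsUnique_iso hA'
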